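/- **Definitions.** A *computable metric space* is a complete metric space $(X,d)$ with a dense sequence $(s_i)_{i\in\mathbb N}$ of *ideal points* such that the reals $d(s_i,s_j)$ are computable uniformly in $(i,j)$. A *name* of $x\in X$ is a $\sigma\in\mathbb N^{\mathbb N}$ with $d(s_{\sigma_n},s_{\sigma_{n+1}})<2^{-n}$ for all $n$ and $s_{\sigma_n}\to x$; the point $x$ is computable if it has a recursive name. A partial function $\mathbb N^{\mathbb N}\to\mathbb N^{\mathbb N}$ is recursive if, at each $\sigma$ of its domain, its value is the limit of the values of some recursive prefix-monotone map $\mathbb N^*\to\mathbb N^*$ on the prefixes of $\sigma$. A function $f:D\to Y$, with $D\subseteq X$, between computable metric spaces is *computable* if some recursive partial function maps every name of every $x\in D$ to a name of $f(x)$. The *ideal balls* are the $B(s_i,q)$ with $q\in\mathbb Q_{>0}$; a sequence of open sets is *uniformly r.e.* if its members are unions of uniformly recursively enumerable families of ideal balls, and a $\Pi^0_2$-set is an intersection $\bigcap_n U_n$ of a uniformly r.e. sequence. A Borel probability measure on $X$ is *computable* if it is a computable point of the space of Borel probability measures with the Prokhorov metric, the ideal points being the measures concentrated on finitely many ideal points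 of $X$ with rational weights. A *computable probability space* $(X,\mu)$ is a computable metric space with a computable Borel probability measure. A *morphism* $F:(X,\mu)\to(Y,\nu)$ is a computable function $F:D_F\to Y$, where $D_F\subseteq X$ is a $\Pi^0_2$-set with $\mu(D_F)=1$, such that $\nu(A)=\mu(F^{-1}(A))$ for all Borel sets $A\subseteq Y$. An *isomorphism* is a pair of morphisms $F:(X,\mu)\to(Y,\nu)$ and $G:(Y,\nu)\to(X,\mu)$ with $G\circ F=\mathrm{id}$ on $F^{-1}(D_G)$ and $F\circ G=\mathrm{id}$ on $G^{-1}(D_F)$. The Cantor space $2^\omega$ carries the metric $d(\omega,\omega')=2^{-\min\{n:\omega_n\ne\omega'_n\}}$ (and $d(\omega,\omega)=0$), its ideal points being the sequences that are eventually $0$. A *binary representation* of $(X,\mu)$ is a pair $(\delta,\mu_\delta)$, where $\mu_\delta$ is a computable probability measure on $2^\omega$ and $\delta:(2^\omega,\mu_\delta)\to(X,\mu)$ is a morphism that maps its domain onto $X$, such that there is a dense $\Pi^0_2$-set $D\subseteq X$ with $\mu(D)=1$ for which every $x\in D$ has exactly one preimage $\delta^{-1}(x)$ (its *expansion*) and $\delta^{-1}:D\to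 2^\omega$ is computable. **Theorem.** Every computable probability space $(X,\mu)$ has a binary representation. Moreover, for every binary representation $(\delta,\mu_\delta)$ of $(X,\mu)$ and every set $D$ as in the definition, the pair $(\delta,\delta^{-1}|_D)$ is an isomorphism between $(2^\omega,\mu_\delta)$ and $(X,\mu)$. Consequently $(X,\mu)$ is isomorphic to the Cantor space with some computable probability measure. -/

import Mathlib

open MeasureTheory Filter Topology
open scoped ENNReal

namespace ComputableProbability

/-! ### Recursive functions on Baire space -/

/-- The prefix `σ 0, …, σ (n - 1)` of a sequence. -/
def initSeg (σ : ℕ → ℕ) (n : ℕ) : List ℕ := (List.range n).map σ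

/-- A partial function `F : ℕ^ℕ → ℕ^ℕ` is recursive if there is a recursive function `F'` on finite
sequences, monotone for the prefix ordering, such that for every `σ` in the domain of `F` the
infinite sequence `F σ` is the limit of the values of `F'` on the prefixes of `σ`. -/
def RecursiveOperator (F : (ℕ → ℕ) →. (ℕ → ℕ)) : Prop :=
  ∃ F' : List ℕ → List ℕ, Computable F' ∧ (∀ u v, u <+: v → F' u <+: F' v) ∧
    ∀ σ, ∀ τ ∈ F σ, ∀ n, ∃ k, initSeg τ n <+: F' (initSeg σ k)

/-! ### Cauchy representation, computable metric spaces -/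

/-- `σ` is a name of `x` for the Cauchy representation given by the ideal points `s i`: the sequence
`s (σ n)` is fast and converges to `x`. -/
def CauchyName {X : Type*} [PseudoMetricSpace X] (s : ℕ → X) (σ : ℕ → ℕ) (x : X) : Prop :=
  (∀ n, dist (s (σ n)) (s (σ (n + 1))) < (1 / 2 : ℝ) ^ n) ∧
    Tendsto (fun n => s (σ n)) atTop (𝓝 x)

/-- A constructive point for the Cauchy representation. -/
def ConstructivePoint {X : Type*} [PseudoMetricSpace X] (s : ℕ → X) (x : X) : Prop :=
  ∃ σ : ℕ → ℕ, Computable σ ∧ CauchyName s σ x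

/-- Uniformly constructive points for the Cauchy representation. -/
def UniformlyConstructive {α X : Type*} [Primcodable α] [PseudoMetricSpace X] (s : ℕ → X)
    (x : α → X) : Prop :=
  ∃ σ : α → ℕ → ℕ, Computable₂ σ ∧ ∀ a, CauchyName s (σ a) (x a)

/-- The numbering `⟨⟨a, b⟩, c⟩ ↦ (a - b) / (c + 1)` of the rational numbers. -/
def ratNum (n : ℕ) : ℚ :=
  ((n.unpair.1.unpair.1 : ℚ) - (n.unpair.1.unpair.2 : ℚ)) / ((n.unpair.2 : ℚ) + 1)

/-- The numbering `⟨a, b⟩ ↦ (a + 1) / (b + 1)` of the positive rational numbers. -/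
def posRatNum (n : ℕ) : ℚ := ((n.unpair.1 : ℚ) + 1) / ((n.unpair.2 : ℚ) + 1)

/-- A computable metric space: a complete metric space with a numbered dense set of ideal points
whose mutual distances are uniformly computable real numbers. -/
class ComputableMetricSpace (X : Type*) [MetricSpace X] extends CompleteSpace X where
  /-- The numbering of the ideal points. -/
  ideal : ℕ → X
  denseRange_ideal : DenseRange ideal
  dist_computable : UniformlyConstructive (fun n => (ratNum n : ℝ))
    (fun p : ℕ × ℕ => dist (ideal p.1) (ideal p.2))


section Topology

variable {X Y : Type*} [MetricSpace X] [ComputableMetricSpace X]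
  [MetricSpace Y] [ComputableMetricSpace Y]

/-- The numbering of the ideal balls `B(s, q)`, `s` an ideal point and `q` a positive rational. -/
def idealBall (X : Type*) [MetricSpace X] [ComputableMetricSpace X] (n : ℕ) : Set X :=
  Metric.ball (ComputableMetricSpace.ideal n.unpair.1) (posRatNum n.unpair.2 : ℝ)

/-- Uniformly r.e. open sets: each `U n` is the union of a set of ideal balls that is recursively
enumerable, uniformly in `n`. -/
def UniformlyREOpen (U : ℕ → Set X) : Prop :=
  ∃ E : ℕ × ℕ → Prop, REPred E ∧ ∀ n, U n = ⋃ i ∈ {i | E (n, i)}, idealBall X i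

/-- `Π⁰₂` subsets of a computable metric space. -/
def IsPiZeroTwo (A : Set X) : Prop :=
  ∃ U : ℕ → Set X, UniformlyREOpen U ∧ A = ⋂ n, U n

/-- A function `f : D → Y` on a subset `D` of `X` is computable if some recursive operator maps every
name of every point `x ∈ D` to a name of `f x`. -/
def ComputableOn {D : Set X} (f : D → Y) : Prop :=
  ∃ F : (ℕ → ℕ) →. (ℕ → ℕ), RecursiveOperator F ∧
    ∀ (x : D) (σ : ℕ → ℕ), CauchyName ComputableMetricSpace.ideal σ (x : X) →
      ∃ τ ∈ F σ, CauchyName ComputableMetricSpace.ideal τ (f x)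

end Topology

/-! ### The Cantor space -/

/-- The metric `d(ω, ω') = 2 ^ (-min {n | ω n ≠ ω' n})` on the Cantor space. -/
noncomputable instance cantorMetricSpace : MetricSpace (ℕ → Bool) :=
  PiNat.metricSpaceOfDiscreteUniformity (fun _ => rfl)

/-- The length of the common binary prefix of two distinct natural numbers. -/
def agreeLength (i j : ℕ) : ℕ := Nat.findGreatest (fun n => i % 2 ^ n = j % 2 ^ n) (i + j)

theorem agreeLength_primrec : Primrec₂ agreeLength := by
  have hpow : Primrec₂ ((· ^ ·) : ℕ → ℕ → ℕ) := Primrec₂.unpaired'.1 Nat.Primrec.pow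
  have hn : Primrec fun q : (ℕ × ℕ) × (ℕ × ℕ) => q.2.1 + 1 :=
    Primrec.succ.comp (Primrec.fst.comp Primrec.snd)
  have hp : Primrec fun q : (ℕ × ℕ) × (ℕ × ℕ) => 2 ^ (q.2.1 + 1) :=
    hpow.comp (Primrec.const 2) hn
  have hc : PrimrecPred fun q : (ℕ × ℕ) × (ℕ × ℕ) =>
      q.1.1 % 2 ^ (q.2.1 + 1) = q.1.2 % 2 ^ (q.2.1 + 1) :=
    Primrec.eq.comp (Primrec.nat_mod.comp (Primrec.fst.comp Primrec.fst) hp)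
      (Primrec.nat_mod.comp (Primrec.snd.comp Primrec.fst) hp)
  have hh : Primrec₂ fun (a : ℕ × ℕ) (b : ℕ × ℕ) =>
      if a.1 % 2 ^ (b.1 + 1) = a.2 % 2 ^ (b.1 + 1) then b.1 + 1 else b.2 :=
    Primrec.ite hc hn (Primrec.snd.comp Primrec.snd)
  refine (Primrec.nat_rec' (f := fun a : ℕ × ℕ => a.1 + a.2)
    (Primrec.nat_add.comp Primrec.fst Primrec.snd) (Primrec.const 0) hh).of_eq ?_
  rintro ⟨i, j⟩
  show _ = agreeLength i j
  unfold agreeLength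
  dsimp only
  induction i + j with
  | zero => simp
  | succ n ih => rw [Nat.findGreatest_succ, ← ih]

theorem mod_two_pow_eq_iff (i j n : ℕ) :
    i % 2 ^ n = j % 2 ^ n ↔ ∀ m < n, i.testBit m = j.testBit m := by
  constructor
  · intro h m hm
    have := congrArg (fun k => Nat.testBit k m) h
    simpa [Nat.testBit_mod_two_pow, hm] using this
  · intro h
    apply Nat.eq_of_testBit_eq
    intro m
    by_cases hm : m < n
    · simp [Nat.testBit_mod_two_pow, hm, h m hm]
    · simp [Nat.testBit_mod_two_pow, hm]

theorem cantor_dist_testBit (i j : ℕ) (h : i ≠ j) :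
    dist i.testBit j.testBit = (1 / 2 : ℝ) ^ agreeLength i j := by
  have hne : i.testBit ≠ j.testBit := fun e => h (Nat.eq_of_testBit_eq (congrFun e))
  have hd : dist i.testBit j.testBit = (1 / 2 : ℝ) ^ PiNat.firstDiff i.testBit j.testBit :=
    PiNat.dist_eq_of_ne (E := fun _ => Bool) hne
  rw [hd]
  congr 1
  have hF : i % 2 ^ PiNat.firstDiff i.testBit j.testBit
      = j % 2 ^ PiNat.firstDiff i.testBit j.testBit :=
    (mod_two_pow_eq_iff i j _).2 fun m hm => PiNat.apply_eq_of_lt_firstDiff hm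
  have hF' := PiNat.apply_firstDiff_ne hne
  set F := PiNat.firstDiff i.testBit j.testBit
  apply le_antisymm
  · refine Nat.le_findGreatest ?_ hF
    by_contra hlt
    push Not at hlt
    apply h
    have hp : F < 2 ^ F := Nat.lt_two_pow_self
    rwa [Nat.mod_eq_of_lt (by omega), Nat.mod_eq_of_lt (by omega)] at hF
  · by_contra hlt
    push Not at hlt
    have hK : i % 2 ^ agreeLength i j = j % 2 ^ agreeLength i j :=
      Nat.findGreatest_spec (P := fun n => i % 2 ^ n = j % 2 ^ n) (Nat.zero_le _)
        (by simp [Nat.mod_one])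
    exact hF' ((mod_two_pow_eq_iff i j _).1 hK F hlt)

theorem cantor_denseRange : DenseRange (fun n m => Nat.testBit n m : ℕ → ℕ → Bool) := by
  intro x
  rw [Metric.mem_closure_range_iff]
  intro ε hε
  obtain ⟨n, hn⟩ := exists_pow_lt_of_lt_one hε (by norm_num : (1 / 2 : ℝ) < 1)
  have key : ∀ n, ∃ k : ℕ, ∀ m < n, k.testBit m = x m := by
    intro n
    refine ⟨Nat.ofBits (fun m : Fin n => x m), fun m hm => ?_⟩
    simp [Nat.testBit_ofBits_lt _ _ hm]
  obtain ⟨k, hk⟩ := key n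
  refine ⟨k, lt_of_le_of_lt ?_ hn⟩
  exact (PiNat.mem_cylinder_iff_dist_le (E := fun _ => Bool)).1 fun m hm => (hk m hm).symm

/-- The Cantor space as a computable metric space: the ideal points are the sequences that are
eventually `0`, the `n`-th one being the sequence of binary digits of `n`. -/
noncomputable instance cantorComputableMetricSpace : ComputableMetricSpace (ℕ → Bool) where
  ideal n := Nat.testBit n
  denseRange_ideal := cantor_denseRange
  dist_computable := by
    have hpow : Primrec₂ ((· ^ ·) : ℕ → ℕ → ℕ) := Primrec₂.unpaired'.1 Nat.Primrec.pow
    refine ⟨fun p _ => if p.1 = p.2 then Nat.pair 0 0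
      else Nat.pair (Nat.pair 1 0) (2 ^ agreeLength p.1 p.2 - 1), ?_, ?_⟩
    · refine Primrec.to_comp (Primrec.ite ?_ (Primrec.const _) ?_)
      · exact Primrec.eq.comp (Primrec.fst.comp Primrec.fst) (Primrec.snd.comp Primrec.fst)
      · exact Primrec₂.natPair.comp (Primrec.const _) (Primrec.nat_sub.comp
          (hpow.comp (Primrec.const 2) (agreeLength_primrec.comp
            (Primrec.fst.comp Primrec.fst) (Primrec.snd.comp Primrec.fst))) (Primrec.const 1))
    · rintro ⟨i, j⟩
      refine ⟨fun n => by simp, ?_⟩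
      by_cases h : i = j
      · subst h
        simp [ratNum]
      · have h1 : 1 ≤ 2 ^ agreeLength i j := Nat.one_le_two_pow
        simp [ratNum, h, cantor_dist_testBit i j h, Nat.cast_sub h1]

/-! ### Computable probability measures -/

section Measures

variable {X : Type*} [MeasurableSpace X]

/-- The measure `∑ (w + 1) δ_{s i}`, the sum being over the entries `(i, w)` of a list. -/
noncomputable def weightedSum (s : ℕ → X) (l : List (ℕ × ℕ)) : Measure X :=
  (l.map fun p => (((p.2 + 1 : ℕ) : ℝ≥0∞) • Measure.dirac (s p.1))).sum

theorem weightedSum_univ (s : ℕ → X) (l : List (ℕ × ℕ)) :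
    weightedSum s l Set.univ = (((l.map fun p => p.2 + 1).sum : ℕ) : ℝ≥0∞) := by
  induction l with
  | nil => simp [weightedSum]
  | cons p l ih =>
    have : weightedSum s (p :: l)
        = ((p.2 + 1 : ℕ) : ℝ≥0∞) • Measure.dirac (s p.1) + weightedSum s l := by
      simp [weightedSum]
    rw [this, Measure.add_apply, ih]
    simp

/-- The numbering of the ideal measures: the probability measures concentrated on finitely many ideal
points and giving them rational weights. An index is decoded as a non-empty list of pairs `(i, w)`,
where `(w + 1) / (sum of all the w + 1)` is the mass put at the `i`-th ideal point. -/
noncomputable def idealMeasure (s : ℕ → X) (n : ℕ) : ProbabilityMeasure X :=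
  let c := Denumerable.ofNat ((ℕ × ℕ) × List (ℕ × ℕ)) n
  ⟨(weightedSum s (c.1 :: c.2) Set.univ)⁻¹ • weightedSum s (c.1 :: c.2), ⟨by
    rw [Measure.smul_apply, smul_eq_mul, weightedSum_univ]
    refine ENNReal.inv_mul_cancel ?_ (ENNReal.natCast_ne_top _)
    rw [List.map_cons, List.sum_cons, Nat.cast_ne_zero]
    omega⟩⟩

/-- A Borel probability measure is computable if it is a constructive point of the space of Borel
probability measures with the Prokhorov metric and the ideal measures. -/
def IsComputableMeasure [MetricSpace X] [ComputableMetricSpace X] [BorelSpace X]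
    (μ : ProbabilityMeasure X) : Prop :=
  ConstructivePoint
    (fun n => LevyProkhorov.ofMeasure (idealMeasure (ComputableMetricSpace.ideal : ℕ → X) n))
    (LevyProkhorov.ofMeasure μ)

end Measures

/-! ### Morphisms and binary representations -/

section Morphisms

variable {X Y : Type*}
  [MetricSpace X] [ComputableMetricSpace X] [MeasurableSpace X] [BorelSpace X]
  [MetricSpace Y] [ComputableMetricSpace Y] [MeasurableSpace Y] [BorelSpace Y]

/-- A morphism `(X, μ) → (Y, ν)` of computable probability spaces: a computable measure-preserving
function defined on a `Π⁰₂` set of full measure. -/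
structure Morphism (μ : ProbabilityMeasure X) (ν : ProbabilityMeasure Y) where
  /-- The domain of the morphism. -/
  dom : Set X
  /-- The underlying function. -/
  toFun : dom → Y
  isPiZeroTwo_dom : IsPiZeroTwo dom
  measure_dom : (μ : Measure X) dom = 1
  computable : ComputableOn toFun
  measure_preimage : ∀ A : Set Y, MeasurableSet A →
    (ν : Measure Y) A = (μ : Measure X) {x | ∃ h : x ∈ dom, toFun ⟨x, h⟩ ∈ A}

/-- An isomorphism of computable probability spaces: a pair of morphisms `F`, `G` with
`G ∘ F = id` on `F⁻¹ (dom G)` and `F ∘ G = id` on `G⁻¹ (dom F)`. -/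
structure Isomorphism (μ : ProbabilityMeasure X) (ν : ProbabilityMeasure Y) where
  /-- The morphism from the first space to the second. -/
  hom : Morphism μ ν
  /-- The morphism from the second space to the first. -/
  inv : Morphism ν μ
  inv_hom : ∀ (x : hom.dom) (h : hom.toFun x ∈ inv.dom), inv.toFun ⟨hom.toFun x, h⟩ = (x : X)
  hom_inv : ∀ (y : inv.dom) (h : inv.toFun y ∈ hom.dom), hom.toFun ⟨inv.toFun y, h⟩ = (y : Y)

/-- The preimages of a point under a morphism. -/
def Morphism.fiber {μ : ProbabilityMeasure X} {ν : ProbabilityMeasure Y} (F : Morphism μ ν) (y : Y) :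
    Set X :=
  {x | ∃ h : x ∈ F.dom, F.toFun ⟨x, h⟩ = y}

/-- A binary representation of `(X, μ)`. The expansions of a point `x` are the elements of
`toMorphism.fiber x`. -/
structure BinaryRepresentation (μ : ProbabilityMeasure X) where
  /-- The measure on the Cantor space. -/
  measure : ProbabilityMeasure (ℕ → Bool)
  isComputableMeasure : IsComputableMeasure measure
  /-- The decoding morphism. -/
  toMorphism : Morphism measure μ
  surjective : Function.Surjective toMorphism.toFun
  /-- The set of points on which the inverse is defined. -/
  D : Set X
  dense_D : Dense D
  measure_D : (μ : Measure X) D = 1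
  isPiZeroTwo_D : IsPiZeroTwo D
  /-- The inverse, mapping a point of `D` to its unique expansion. -/
  inverse : D → (ℕ → Bool)
  fiber_eq : ∀ x : D, toMorphism.fiber (x : X) = {inverse x}
  computable_inverse : ComputableOn inverse

end Morphisms

end ComputableProbability

open ComputableProbability

/-! Digit `⟨i, k⟩` of the expansion of `x` says whether `2 ^ k * d(s i, x) < α`, that is, whether
`x` lies in the ball of radius `α / 2 ^ k` about the `i`-th ideal point. One real threshold `α ∈ [1,
2]` serves all balls. It must be computable, no sphere in question may carry mass, and no ideal
point may lie on such a sphere. The points on none of these spheres are called regular.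

The threshold is the limit of nested dyadic intervals found by search (`exists_threshold`). At stage
`n` the next interval must be visibly separated from the first levels of the first ideal points, and
from those of all but a fraction `2 ^ (-n)` of the atoms of an ideal measure close to `μ`. This is a
decidable condition on integers. The search succeeds because all but countably many numbers are
values of each level on a null set only and are avoided by the ideal points (`exists_admissible`).
Conversely, these conditions force every sphere to be null (`measure_level_eq`).

At a regular point every comparison is eventually decided, so the expansion is computable there.
Replacing each atom of the approximating ideal measures by the digits read off for it approximates
the law of the expansions at a geometric rate (`dist_law_le`), so the law is a computable measure.

For decoding, a sequence with a digit `1` at every scale, all of whose prefixes come from ideal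
points, determines one point by completeness (`exists_represents`, `Represents.unique`). Every point
arises in this way, even a nonregular one, by compactness of the Cantor space (`surjective_decode`).
A regular point has exactly one code.

For an arbitrary binary representation, computable maps are continuous, hence measurable, and almost
every sequence is decoded into `D`. The inverse therefore preserves measure, and it undoes the
decoding map (`BinaryRepresentation.isomorphism`). -/

namespace ComputableProbability

/-! ### Closure properties of computable functions -/

section Recursion

variable {α β γ : Type*} [Primcodable α] [Primcodable β] [Primcodable γ]

theorem primrec_natPow : Primrec₂ ((· ^ ·) : ℕ → ℕ → ℕ) :=
  Primrec₂.unpaired'.1 Nat.Primrec.pow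

theorem computable_add {f g : α → ℕ} (hf : Computable f) (hg : Computable g) :
    Computable fun a => f a + g a := Primrec.nat_add.to_comp.comp hf hg

theorem computable_sub {f g : α → ℕ} (hf : Computable f) (hg : Computable g) :
    Computable fun a => f a - g a := Primrec.nat_sub.to_comp.comp hf hg

theorem computable_mul {f g : α → ℕ} (hf : Computable f) (hg : Computable g) :
    Computable fun a => f a * g a := Primrec.nat_mul.to_comp.comp hf hg

theorem computable_div {f g : α → ℕ} (hf : Computable f) (hg : Computable g) :
    Computable fun a => f a / g a := Primrec.nat_div.to_comp.comp hf hg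

theorem computable_two_pow {f : α → ℕ} (hf : Computable f) :
    Computable fun a => 2 ^ f a := primrec_natPow.to_comp.comp (.const 2) hf

theorem computable_pair {f g : α → ℕ} (hf : Computable f) (hg : Computable g) :
    Computable fun a => Nat.pair (f a) (g a) := Primrec₂.natPair.to_comp.comp hf hg

theorem computable_unpair_fst {f : α → ℕ} (hf : Computable f) :
    Computable fun a => (f a).unpair.1 := Computable.fst.comp (Computable.unpair.comp hf)

theorem computable_unpair_snd {f : α → ℕ} (hf : Computable f) :
    Computable fun a => (f a).unpair.2 := Computable.snd.comp (Computable.unpair.comp hf)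

theorem computable_decide_lt {f g : α → ℕ} (hf : Computable f) (hg : Computable g) :
    Computable fun a => decide (f a < g a) :=
  (PrimrecRel.decide Primrec.nat_lt).to_comp.comp hf hg

theorem computable_decide_le {f g : α → ℕ} (hf : Computable f) (hg : Computable g) :
    Computable fun a => decide (f a ≤ g a) :=
  (PrimrecRel.decide Primrec.nat_le).to_comp.comp hf hg

theorem computable_decide_eq {f g : α → ℕ} (hf : Computable f) (hg : Computable g) :
    Computable fun a => decide (f a = g a) :=
  (PrimrecRel.decide (Primrec.eq (α := ℕ))).to_comp.comp hf hg

theorem computable_and {f g : α → Bool} (hf : Computable f) (hg : Computable g) :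
    Computable fun a => f a && g a := Primrec.and.to_comp.comp hf hg

theorem computable_or {f g : α → Bool} (hf : Computable f) (hg : Computable g) :
    Computable fun a => f a || g a := Primrec.or.to_comp.comp hf hg

theorem computable_not {f : α → Bool} (hf : Computable f) :
    Computable fun a => !f a := Primrec.not.to_comp.comp hf

/-- Bounded universal quantification: `p i` for all `i < n`. -/
def allLT (p : ℕ → Bool) (n : ℕ) : Bool := Nat.rec true (fun i b => b && p i) n

theorem allLT_eq_true {p : ℕ → Bool} {n : ℕ} : allLT p n = true ↔ ∀ i < n, p i = true := by
  induction n with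
  | zero => simp [allLT]
  | succ n ih =>
    have : allLT p (n + 1) = (allLT p n && p n) := rfl
    rw [this, Bool.and_eq_true, ih]
    constructor
    · rintro ⟨h1, h2⟩ i hi
      rcases Nat.lt_succ_iff_lt_or_eq.1 hi with h | rfl
      exacts [h1 i h, h2]
    · exact fun h => ⟨fun i hi => h i (by omega), h n (by omega)⟩

theorem computable_allLT {p : α → ℕ → Bool} {n : α → ℕ} (hp : Computable₂ p) (hn : Computable n) :
    Computable fun a => allLT (p a) (n a) := by
  refine Computable.nat_rec (h := fun a q => q.2 && p a q.1) hn (.const true) ?_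
  exact computable_and (Computable.snd.comp .snd)
    (hp.comp .fst (Computable.fst.comp .snd))

/-- The natural number with binary digits `p 0, …, p (n - 1)`. -/
def bitsLT (p : ℕ → Bool) (n : ℕ) : ℕ := Nat.rec 0 (fun i b => b + bif p i then 2 ^ i else 0) n

theorem bitsLT_succ (p : ℕ → Bool) (n : ℕ) :
    bitsLT p (n + 1) = bitsLT p n + bif p n then 2 ^ n else 0 := rfl

theorem bitsLT_lt (p : ℕ → Bool) (n : ℕ) : bitsLT p n < 2 ^ n := by
  induction n with
  | zero => simp [bitsLT]
  | succ n ih =>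
    rw [bitsLT_succ, pow_succ]
    cases p n <;> simp <;> omega

theorem testBit_bitsLT (p : ℕ → Bool) {n i : ℕ} (hi : i < n) : (bitsLT p n).testBit i = p i := by
  induction n with
  | zero => omega
  | succ n ih =>
    rw [bitsLT_succ]
    rcases Nat.lt_succ_iff_lt_or_eq.1 hi with h | rfl
    · cases p n
      · simpa using ih h
      · rw [cond_true, add_comm, Nat.testBit_two_pow_add_gt h, ih h]
    · have := bitsLT_lt p i
      cases hp : p i
      · simpa using Nat.testBit_lt_two_pow this
      · rw [cond_true, add_comm, Nat.testBit_two_pow_add_eq, Nat.testBit_lt_two_pow this]; rfl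

theorem computable_bitsLT {p : α → ℕ → Bool} {n : α → ℕ} (hp : Computable₂ p) (hn : Computable n) :
    Computable fun a => bitsLT (p a) (n a) := by
  refine Computable.nat_rec (h := fun a q => q.2 + bif p a q.1 then 2 ^ q.1 else 0) hn (.const 0) ?_
  have h1 : Computable fun q : α × ℕ × ℕ => q.2.1 := Computable.fst.comp .snd
  exact computable_add (Computable.snd.comp .snd)
    (Computable.cond (hp.comp .fst h1) (computable_two_pow h1) (.const 0))

/-- Folding is recursion on the number of entries consumed. Lookups below the length succeed, so the
default branch of `getD` is never taken. -/
theorem computable_list_foldl {f : α → List β} {g : α → γ} {h : α → γ → β → γ} (hf : Computable f)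
    (hg : Computable g) (hh : Computable fun q : α × γ × β => h q.1 q.2.1 q.2.2) :
    Computable fun a => (f a).foldl (h a) (g a) := by
  have hstep : Computable₂ fun (a : α) (q : ℕ × γ) =>
      ((f a)[q.1]?.map (h a q.2)).getD q.2 := by
    refine Computable.option_getD (Computable.option_map ?_ ?_) (Computable.snd.comp .snd)
    · exact Computable.list_getElem?.comp (hf.comp .fst) (Computable.fst.comp .snd)
    · exact hh.comp (Computable.pair (Computable.fst.comp .fst)
        (Computable.pair (Computable.snd.comp (Computable.snd.comp .fst)) .snd))
  refine (Computable.nat_rec (Computable.list_length.comp hf) hg hstep).of_eq fun a => ?_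
  have key : ∀ n, n ≤ (f a).length →
      (Nat.rec (g a) (fun i acc => ((f a)[i]?.map (h a acc)).getD acc) n : γ)
        = ((f a).take n).foldl (h a) (g a) := by
    intro n
    induction n with
    | zero => simp
    | succ n ih =>
      intro hn
      have hn' : n < (f a).length := hn
      simp only [ih hn'.le, List.take_add_one, List.foldl_append]
      simp [hn']
  simpa using key _ le_rfl

theorem computable_list_map {f : α → List β} {g : α → β → γ} (hf : Computable f)
    (hg : Computable₂ g) : Computable fun a => (f a).map (g a) := by
  refine (computable_list_foldl (h := fun a acc b => acc ++ [g a b]) hf (.const []) ?_).of_eq ?_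
  · exact Computable.list_concat.comp (Computable.fst.comp .snd)
      (hg.comp .fst (Computable.snd.comp .snd))
  · intro a
    have : ∀ (l : List β) (acc : List γ),
        l.foldl (fun acc b => acc ++ [g a b]) acc = acc ++ l.map (g a) := by
      intro l
      induction l with
      | nil => simp
      | cons b l ih => intro acc; simp [ih]
    simp [this]

theorem computable_list_sum {f : α → List ℕ} (hf : Computable f) :
    Computable fun a => (f a).sum := by
  refine (computable_list_foldl (h := fun _ acc b => acc + b) hf (.const 0) ?_).of_eq ?_
  · exact computable_add (Computable.fst.comp .snd) (Computable.snd.comp .snd)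
  · intro a
    exact List.sum_eq_foldl.symm

/-- A computable relation that is total has a computable choice function. -/
theorem exists_computable_choice (P : α → ℕ → Bool) (hP : Computable₂ P)
    (h : ∀ a, ∃ n, P a n = true) : ∃ f : α → ℕ, Computable f ∧ ∀ a, P a (f a) = true := by
  refine ⟨fun a => Nat.find (h a), ?_, fun a => Nat.find_spec (h a)⟩
  refine Partrec.of_eq_tot (Partrec.rfind (p := fun a n => Part.some (P a n)) hP.partrec₂) ?_
  intro a
  refine Nat.mem_rfind.2 ⟨?_, fun {m} hm => ?_⟩
  · simpa using (Nat.find_spec (h a)).symm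
  · simpa using Nat.find_min (h a) hm

/-- The projection of a computable relation is recursively enumerable. -/
theorem rePred_exists (P : α → ℕ → Bool) (hP : Computable₂ P) :
    REPred fun a => ∃ n, P a n = true := by
  refine (Partrec.rfind (p := fun a n => Part.some (P a n)) hP.partrec₂).dom_re.of_eq fun a => ?_
  refine Nat.rfind_dom.trans ⟨?_, ?_⟩
  · rintro ⟨n, hn, -⟩
    exact ⟨n, (Part.mem_some_iff.1 hn).symm⟩
  · rintro ⟨n, hn⟩
    exact ⟨n, Part.mem_some_iff.2 hn.symm, fun _ => trivial⟩

end Recursion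

/-! ### Recursive operators from certificates -/

section Operators

theorem length_initSeg (σ : ℕ → ℕ) (n : ℕ) : (initSeg σ n).length = n := by simp [initSeg]

theorem getElem?_initSeg (σ : ℕ → ℕ) {n m : ℕ} (h : m < n) : (initSeg σ n)[m]? = some (σ m) := by
  simp [initSeg, h]

theorem initSeg_congr {σ τ : ℕ → ℕ} {n : ℕ} (h : ∀ m < n, σ m = τ m) :
    initSeg σ n = initSeg τ n :=
  List.map_congr_left fun m hm => h m (List.mem_range.1 hm)

theorem take_initSeg (σ : ℕ → ℕ) {n m : ℕ} (h : m ≤ n) : (initSeg σ n).take m = initSeg σ m := by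
  simp [initSeg, ← List.map_take, List.take_range, h]

theorem initSeg_prefix_of_le (σ : ℕ → ℕ) {n m : ℕ} (h : m ≤ n) : initSeg σ m <+: initSeg σ n := by
  rw [← take_initSeg σ h]
  exact List.take_prefix _ _

theorem getElem?_of_initSeg_le {σ : ℕ → ℕ} {n : ℕ} {l : List ℕ} (h : initSeg σ (n + 1) <+: l) :
    l[n]? = some (σ n) := by
  obtain ⟨t, rfl⟩ := h
  rw [List.getElem?_append_left (by simp [length_initSeg]), getElem?_initSeg σ (Nat.lt_succ_self n)]

theorem apply_eq_of_initSeg_le {σ τ : ℕ → ℕ} {n : ℕ} {l l' : List ℕ}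
    (hσ : initSeg σ (n + 1) <+: l) (hτ : initSeg τ (n + 1) <+: l') (hl : l <+: l') : σ n = τ n :=
  Option.some_injective _
    ((getElem?_of_initSeg_le (hσ.trans hl)).symm.trans (getElem?_of_initSeg_le hτ))

/-- The first value among `c []`, `c [u 0]`, …, `c u` that is defined. -/
def firstValue (c : List ℕ → Option ℕ) (u : List ℕ) : ℕ → Option ℕ :=
  Nat.rec none fun i o => Option.casesOn o (c (u.take i)) some

theorem firstValue_succ (c : List ℕ → Option ℕ) (u : List ℕ) (n : ℕ) :
    firstValue c u (n + 1) = Option.casesOn (firstValue c u n) (c (u.take n)) some := rfl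

/-- Prefixes are scanned in order of length, and those of length at most `u.length` are shared with
every extension `v`. The first value found is therefore final. -/
theorem firstValue_mono {c : List ℕ → Option ℕ} {u v : List ℕ} (huv : u <+: v) {m n a : ℕ}
    (hm : m ≤ u.length + 1) (hmn : m ≤ n) (h : firstValue c u m = some a) :
    firstValue c v n = some a := by
  have key : ∀ m ≤ u.length + 1, firstValue c v m = firstValue c u m := by
    intro m
    induction m with
    | zero => intro _; rfl
    | succ m ih =>
      intro hm
      have : v.take m = u.take m := by
        obtain ⟨t, rfl⟩ := huv
        rw [List.take_append_of_le_length (by omega)]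
      rw [firstValue_succ, firstValue_succ, ih (by omega), this]
  induction n, hmn using Nat.le_induction with
  | base => rw [key m hm, h]
  | succ n _ ih => rw [firstValue_succ, ih]

theorem exists_of_firstValue {c : List ℕ → Option ℕ} {u : List ℕ} {n a : ℕ}
    (h : firstValue c u n = some a) : ∃ i < n, c (u.take i) = some a := by
  induction n with
  | zero => cases h
  | succ n ih =>
    rw [firstValue_succ] at h
    cases hn : firstValue c u n with
    | none => rw [hn] at h; exact ⟨n, by omega, h⟩
    | some b =>
      rw [hn] at h
      obtain ⟨i, hi, h'⟩ := ih (hn.trans h)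
      exact ⟨i, by omega, h'⟩

theorem firstValue_isSome {c : List ℕ → Option ℕ} {u : List ℕ} {i n : ℕ} (hi : i < n)
    (h : (c (u.take i)).isSome) : (firstValue c u n).isSome := by
  induction n with
  | zero => omega
  | succ n ih =>
    rw [firstValue_succ]
    cases hn : firstValue c u n with
    | some b => rfl
    | none =>
      rcases Nat.lt_succ_iff_lt_or_eq.1 hi with h' | rfl
      · simpa [hn] using ih h'
      · exact h

/-- The length of the longest block `0, …, k - 1` with `k ≤ n` on which `p` holds. -/
def blockLength (p : ℕ → Bool) (n : ℕ) : ℕ :=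
  Nat.rec 0 (fun i b => bif allLT p (i + 1) then i + 1 else b) n

theorem lt_blockLength {p : ℕ → Bool} {n m : ℕ} :
    m < blockLength p n ↔ m < n ∧ ∀ i ≤ m, p i = true := by
  induction n with
  | zero => simp [blockLength]
  | succ n ih =>
    have hs : blockLength p (n + 1) = bif allLT p (n + 1) then n + 1 else blockLength p n := rfl
    rw [hs]
    cases h : allLT p (n + 1)
    · rw [cond_false, ih]
      refine and_congr_left fun h' => ⟨fun h => by omega, fun hm => ?_⟩
      rcases Nat.lt_succ_iff_lt_or_eq.1 hm with h1 | rfl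
      · exact h1
      · rw [allLT_eq_true.2 fun i hi => h' i (by omega)] at h
        cases h
    · rw [cond_true]
      exact ⟨fun hm => ⟨hm, fun i hi => allLT_eq_true.1 h i (by omega)⟩, fun hm => hm.1⟩

/-- The monotone map on finite sequences defined by a family of partial certificates. -/
def certificateMap (c : ℕ → List ℕ → Option ℕ) (u : List ℕ) : List ℕ :=
  (List.range (blockLength (fun m => (firstValue (c m) u (u.length + 1)).isSome) u.length)).map
    fun m => (firstValue (c m) u (u.length + 1)).getD 0

theorem computable_certificateMap {c : ℕ → List ℕ → Option ℕ} (hc : Computable₂ c) :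
    Computable (certificateMap c) := by
  have hfirst : Computable₂ fun (u : List ℕ) (m : ℕ) => firstValue (c m) u (u.length + 1) := by
    refine Computable.nat_rec
      (h := fun (q : List ℕ × ℕ) (r : ℕ × Option ℕ) =>
        Option.casesOn (motive := fun _ => Option ℕ) r.2 (c q.2 (q.1.take r.1)) some)
      (Computable.succ.comp (Computable.list_length.comp .fst)) (.const none) ?_
    refine Computable.option_casesOn (Computable.snd.comp .snd) ?_ ?_
    · refine hc.comp (Computable.snd.comp .fst) (Primrec.list_take.to_comp.comp
        (Computable.fst.comp .snd) (Computable.fst.comp .fst))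
    · exact Computable.option_some.comp .snd
  have hblock : Computable fun u : List ℕ =>
      blockLength (fun m => (firstValue (c m) u (u.length + 1)).isSome) u.length := by
    refine Computable.nat_rec
      (h := fun (u : List ℕ) (r : ℕ × ℕ) =>
        bif allLT (fun m => (firstValue (c m) u (u.length + 1)).isSome) (r.1 + 1)
          then r.1 + 1 else r.2) Computable.list_length (.const 0) ?_
    have h1 : Computable fun q : List ℕ × ℕ × ℕ => q.2.1 + 1 :=
      Computable.succ.comp (Computable.fst.comp .snd)
    refine Computable.cond (computable_allLT ?_ h1) h1 (Computable.snd.comp .snd)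
    exact Primrec.option_isSome.to_comp.comp (hfirst.comp (Computable.fst.comp .fst) .snd)
  exact computable_list_map (Primrec.list_range.to_comp.comp hblock)
    (Computable.option_getD hfirst (.const 0))

/-- Values once found are kept, so the initial block of settled positions can only grow. Only
settled positions are output, so the default `0` never appears. -/
theorem certificateMap_mono (c : ℕ → List ℕ → Option ℕ) {u v : List ℕ} (huv : u <+: v) :
    certificateMap c u <+: certificateMap c v := by
  have hlen : u.length ≤ v.length := huv.length_le
  have hval : ∀ m a, firstValue (c m) u (u.length + 1) = some a →
      firstValue (c m) v (v.length + 1) = some a :=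
    fun m a h => firstValue_mono huv le_rfl (by omega) h
  have hN : blockLength (fun m => (firstValue (c m) u (u.length + 1)).isSome) u.length
      ≤ blockLength (fun m => (firstValue (c m) v (v.length + 1)).isSome) v.length := by
    by_contra hlt
    push Not at hlt
    have h := lt_blockLength.1 hlt
    refine lt_irrefl _ (lt_blockLength.2 ⟨h.1.trans_le hlen, fun i hi => ?_⟩)
    obtain ⟨a, ha⟩ := Option.isSome_iff_exists.1 (h.2 i hi)
    exact Option.isSome_iff_exists.2 ⟨a, hval i a ha⟩
  refine List.prefix_iff_eq_take.2 ?_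
  unfold certificateMap
  rw [← List.map_take, List.take_range, List.length_map, List.length_range, min_eq_left hN]
  refine List.map_congr_left fun m hm => ?_
  obtain ⟨a, ha⟩ := Option.isSome_iff_exists.1 ((lt_blockLength.1 (List.mem_range.1 hm)).2 m le_rfl)
  rw [ha, hval m a ha]

variable {X Y : Type*} [MetricSpace X] [ComputableMetricSpace X]
  [MetricSpace Y] [ComputableMetricSpace Y]

/-- A function is computable if the entries of a name of the value can be read off from certificates
found along any name of the argument. -/
theorem computableOn_of_certificates {D : Set X} {f : D → Y} {c : ℕ → List ℕ → Option ℕ}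
    (hc : Computable₂ c)
    (hdef : ∀ (x : D) (σ : ℕ → ℕ), CauchyName ComputableMetricSpace.ideal σ (x : X) →
      ∀ m, ∃ k, (c m (initSeg σ k)).isSome)
    (hname : ∀ (x : D) (σ τ : ℕ → ℕ), CauchyName ComputableMetricSpace.ideal σ (x : X) →
      (∀ m, ∃ k, c m (initSeg σ k) = some (τ m)) → CauchyName ComputableMetricSpace.ideal τ (f x)) :
    ComputableOn f := by
  classical
  let lim : (ℕ → ℕ) → (ℕ → ℕ) → Prop := fun σ τ =>
    ∀ n, ∃ k, initSeg τ n <+: certificateMap c (initSeg σ k)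
  -- The domain consists of all `σ` along which the outputs grow to an infinite sequence.
  -- Monotonicity makes that limit unique, so the choice is harmless.
  refine ⟨fun σ => ⟨∃ τ, lim σ τ, fun h => h.choose⟩,
    ⟨certificateMap c, computable_certificateMap hc, fun u v => certificateMap_mono c, ?_⟩, ?_⟩
  · rintro σ τ ⟨h, rfl⟩
    exact h.choose_spec
  · intro x σ hσ
    have hlim : ∃ τ, lim σ τ ∧ ∀ m, ∃ k, c m (initSeg σ k) = some (τ m) := by
      choose k hk using hdef x σ hσ
      have hfirst : ∀ m, ∃ a, firstValue (c m) (initSeg σ (k m)) (k m + 1) = some a := fun m => by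
        refine Option.isSome_iff_exists.1 (firstValue_isSome (i := k m) (by omega) ?_)
        rw [take_initSeg σ le_rfl]
        exact hk m
      choose τ hτ using hfirst
      refine ⟨τ, fun n => ?_, fun m => ?_⟩
      -- `K` has to exceed `m` as well as `k m`, because the block of outputs is no longer than the
      -- prefix read.
      · obtain ⟨K, hK⟩ : ∃ K, ∀ m < n, k m ≤ K ∧ m < K := by
          refine ⟨(Finset.range n).sup k + n, fun m hm => ?_⟩
          have := Finset.le_sup (f := k) (Finset.mem_range.2 hm)
          omega
        have hval : ∀ m < n, firstValue (c m) (initSeg σ K) (K + 1) = some (τ m) := fun m hm =>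
          firstValue_mono (initSeg_prefix_of_le σ (hK m hm).1) (by rw [length_initSeg])
            (by have := (hK m hm).1; omega) (hτ m)
        refine ⟨K, List.prefix_iff_eq_take.2 ?_⟩
        unfold certificateMap
        rw [← List.map_take, List.take_range, length_initSeg, length_initSeg, min_eq_left]
        · refine List.map_congr_left fun m hm => ?_
          rw [hval m (List.mem_range.1 hm)]
          rfl
        · by_contra hlt
          push Not at hlt
          refine lt_irrefl _ (lt_blockLength.2 ⟨(hK _ hlt).2, fun i hi => ?_⟩)
          simp [hval i (hi.trans_lt hlt)]
      · obtain ⟨i, hi, h⟩ := exists_of_firstValue (hτ m)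
        rw [take_initSeg σ (by omega)] at h
        exact ⟨i, h⟩
    have hex : ∃ τ, lim σ τ := ⟨_, hlim.choose_spec.1⟩
    refine ⟨hex.choose, ⟨hex, rfl⟩, ?_⟩
    obtain ⟨τ, hτ, hτ'⟩ := hlim
    have heq : hex.choose = τ := by
      funext n
      obtain ⟨k, hk⟩ := hex.choose_spec (n + 1)
      obtain ⟨k', hk'⟩ := hτ (n + 1)
      exact apply_eq_of_initSeg_le
        (hk.trans (certificateMap_mono c (initSeg_prefix_of_le σ (le_max_left k k'))))
        (hk'.trans (certificateMap_mono c (initSeg_prefix_of_le σ (le_max_right k k'))))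
        (List.prefix_refl _)
    rw [heq]
    exact hname x σ τ hσ hτ'

end Operators

/-! ### Names, and continuity of computable functions -/

section Continuity

theorem CauchyName.dist_le {X : Type*} [PseudoMetricSpace X] {s : ℕ → X} {σ : ℕ → ℕ} {x : X}
    (h : CauchyName s σ x) (n : ℕ) : dist (s (σ n)) x ≤ 2 / 2 ^ n := by
  refine dist_le_of_le_geometric_two_of_tendsto (f := fun n => s (σ n)) (fun k => ?_) h.2 n
  refine (h.1 k).le.trans_eq ?_
  rw [div_self two_ne_zero, one_div_pow]

theorem cauchyName_of_dist_le {X : Type*} [PseudoMetricSpace X] {s : ℕ → X} {σ : ℕ → ℕ} {x : X}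
    (h : ∀ n, dist (s (σ n)) x ≤ (1 / 2) ^ (n + 1)) : CauchyName s σ x := by
  refine ⟨fun n => ?_, ?_⟩
  · have h1 := dist_triangle_right (s (σ n)) (s (σ (n + 1))) x
    have h2 := h n
    have h3 := h (n + 1)
    have h4 : (0 : ℝ) < (1 / 2) ^ n := by positivity
    rw [pow_succ] at h2
    rw [pow_succ, pow_succ] at h3
    linarith
  · rw [tendsto_iff_dist_tendsto_zero]
    refine squeeze_zero (fun _ => dist_nonneg) h ?_
    exact (tendsto_pow_atTop_nhds_zero_of_lt_one (by norm_num) (by norm_num)).comp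
      (tendsto_add_atTop_nat 1)

/-- A point approximated at a geometric rate by a computable sequence of ideal points is
constructive. -/
theorem constructivePoint_of_dist_le {X : Type*} [PseudoMetricSpace X] {s : ℕ → X} {x : X}
    {σ : ℕ → ℕ} (hσ : Computable σ) (c : ℕ) (h : ∀ n, dist (s (σ n)) x ≤ 2 ^ c * (1 / 2) ^ n) :
    ConstructivePoint s x := by
  refine ⟨fun n => σ (n + 1 + c), hσ.comp (computable_add Computable.succ (.const c)),
    cauchyName_of_dist_le fun n => (h _).trans_eq ?_⟩
  rw [pow_add (1 / 2 : ℝ) (n + 1) c, mul_comm, mul_assoc, ← mul_pow]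
  norm_num

variable {X Y : Type*} [MetricSpace X] [ComputableMetricSpace X]
  [MetricSpace Y] [ComputableMetricSpace Y]

theorem exists_ideal_dist_lt (x : X) {ε : ℝ} (hε : 0 < ε) :
    ∃ j, dist (ComputableMetricSpace.ideal j) x < ε := by
  obtain ⟨j, hj⟩ := Metric.denseRange_iff.1 ComputableMetricSpace.denseRange_ideal x ε hε
  exact ⟨j, by rwa [dist_comm]⟩

/-- Entry `n` of the output depends on a finite prefix of the name of `x`. Every point of `D` close
to `x` has a name with the same prefix, so both values are within `2 / 2 ^ n` of the same ideal
point. -/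
theorem ComputableOn.continuous {D : Set X} {f : D → Y} (hf : ComputableOn f) : Continuous f := by
  obtain ⟨F, ⟨F', -, hmono, hlim⟩, hF⟩ := hf
  have happrox : ∀ (x : X) (n : ℕ),
      ∃ j, dist (ComputableMetricSpace.ideal j) x < (1 / 2) ^ (n + 2) :=
    fun x n => exists_ideal_dist_lt x (by positivity)
  choose name hnm using happrox
  rw [Metric.continuous_iff]
  intro x ε hε
  obtain ⟨n, hn⟩ : ∃ n : ℕ, (4 : ℝ) / 2 ^ n < ε := by
    obtain ⟨n, hn⟩ := exists_pow_lt_of_lt_one (div_pos hε four_pos)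
      (by norm_num : (1 / 2 : ℝ) < 1)
    refine ⟨n, ?_⟩
    rw [one_div_pow, lt_div_iff₀ four_pos] at hn
    rw [div_eq_mul_one_div]
    linarith
  have hx : CauchyName ComputableMetricSpace.ideal (name x) (x : X) :=
    cauchyName_of_dist_le fun m => (hnm x m).le.trans
      (pow_le_pow_of_le_one (by norm_num) (by norm_num) (by omega))
  obtain ⟨τ, hτ, hτn⟩ := hF x _ hx
  obtain ⟨k, hk⟩ := hlim _ τ hτ (n + 1)
  refine ⟨(1 / 2) ^ (k + 2), by positivity, fun y hxy => ?_⟩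
  -- The entries of `name x` are twice as precise as a name requires, so the first `k` of them still
  -- serve for a point at distance less than `2 ^ (-(k + 2))`.
  let σ : ℕ → ℕ := fun m => if m < k then name x m else name y m
  have hy : CauchyName ComputableMetricSpace.ideal σ (y : X) := by
    refine cauchyName_of_dist_le fun m => ?_
    by_cases hm : m < k
    · have h1 : dist (ComputableMetricSpace.ideal (σ m)) (x : X) < (1 / 2) ^ (m + 2) := by
        simpa [σ, hm] using hnm x m
      have h2 : dist (x : X) y < (1 / 2) ^ (k + 2) := by rw [dist_comm]; exact hxy
      have h3 : (1 / 2 : ℝ) ^ (k + 2) ≤ (1 / 2) ^ (m + 2) :=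
        pow_le_pow_of_le_one (by norm_num) (by norm_num) (by omega)
      have h4 : (1 / 2 : ℝ) ^ (m + 1) = (1 / 2) ^ (m + 2) + (1 / 2) ^ (m + 2) := by ring
      have := dist_triangle (ComputableMetricSpace.ideal (σ m)) (x : X) y
      linarith
    · have h1 : dist (ComputableMetricSpace.ideal (σ m)) (y : X) < (1 / 2) ^ (m + 2) := by
        simpa [σ, hm] using hnm y m
      exact h1.le.trans (pow_le_pow_of_le_one (by norm_num) (by norm_num) (by omega))
  obtain ⟨τ', hτ', hτn'⟩ := hF y _ hy
  obtain ⟨k', hk'⟩ := hlim _ τ' hτ' (n + 1)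
  have hseg : initSeg (name x) k = initSeg σ k := initSeg_congr fun m hm => by simp [σ, hm]
  rw [hseg] at hk
  have heq : τ n = τ' n := apply_eq_of_initSeg_le
    (hk.trans (hmono _ _ (initSeg_prefix_of_le σ (le_max_left k k'))))
    (hk'.trans (hmono _ _ (initSeg_prefix_of_le σ (le_max_right k k')))) (List.prefix_refl _)
  have h1 := hτn.dist_le n
  have h2 := hτn'.dist_le n
  rw [← heq] at h2
  have h3 := dist_triangle_left (f y) (f x) (ComputableMetricSpace.ideal (τ n))
  have h4 : (4 : ℝ) / 2 ^ n = 2 / 2 ^ n + 2 / 2 ^ n := by ring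
  linarith

theorem isOpen_idealBall (n : ℕ) : IsOpen (idealBall X n) := Metric.isOpen_ball

theorem UniformlyREOpen.isOpen {U : ℕ → Set X} (hU : UniformlyREOpen U) (n : ℕ) : IsOpen (U n) := by
  obtain ⟨E, -, h⟩ := hU
  rw [h n]
  exact isOpen_biUnion fun i _ => isOpen_idealBall i

theorem IsPiZeroTwo.measurableSet [MeasurableSpace X] [BorelSpace X] {A : Set X}
    (hA : IsPiZeroTwo A) : MeasurableSet A := by
  obtain ⟨U, hU, rfl⟩ := hA
  exact MeasurableSet.iInter fun n => (hU.isOpen n).measurableSet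

/-- A sequence of unions of uniformly computable families of ideal balls is uniformly r.e. -/
theorem uniformlyREOpen_of_computable {U : ℕ → Set X} {P : ℕ → ℕ → Bool} {g : ℕ → ℕ → ℕ}
    (hP : Computable₂ P) (hg : Computable₂ g)
    (hU : ∀ n x, x ∈ U n ↔ ∃ t, P n t = true ∧ x ∈ idealBall X (g n t)) : UniformlyREOpen U := by
  refine ⟨_, rePred_exists (fun (q : ℕ × ℕ) t => P q.1 t && decide (g q.1 t = q.2)) ?_, ?_⟩
  · have h1 : Computable fun q : (ℕ × ℕ) × ℕ => q.1.1 := Computable.fst.comp .fst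
    exact computable_and (hP.comp h1 .snd)
      (computable_decide_eq (hg.comp h1 .snd) (Computable.snd.comp .fst))
  · intro n
    ext x
    rw [hU]
    simp only [Set.mem_ofPred_eq, Set.mem_iUnion, Bool.and_eq_true, decide_eq_true_eq, exists_prop]
    constructor
    · rintro ⟨t, h1, h2⟩
      exact ⟨_, ⟨t, h1, rfl⟩, h2⟩
    · rintro ⟨_, ⟨t, h1, rfl⟩, h2⟩
      exact ⟨t, h1, h2⟩

end Continuity

/-! ### Binary representations are isomorphisms -/

section Isomorphisms

variable {X : Type*} [MetricSpace X] [ComputableMetricSpace X] [MeasurableSpace X]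
  {μ : ProbabilityMeasure X}

theorem measurableSet_subtype_preimage {Y Z : Type*} [MeasurableSpace Y] [TopologicalSpace Y]
    [BorelSpace Y] [MeasurableSpace Z] [TopologicalSpace Z] [BorelSpace Z] {D : Set Y} {f : D → Z}
    (hD : MeasurableSet D) (hf : Continuous f) {A : Set Z} (hA : MeasurableSet A) :
    MeasurableSet {x | ∃ h : x ∈ D, f ⟨x, h⟩ ∈ A} := by
  have : {x | ∃ h : x ∈ D, f ⟨x, h⟩ ∈ A} = Subtype.val '' (f ⁻¹' A) := by
    ext x
    simp
  rw [this]
  exact hD.subtype_image (hf.measurable hA)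

namespace BinaryRepresentation

theorem exists_inverse_mem (R : BinaryRepresentation μ) (x : R.D) :
    ∃ h : R.inverse x ∈ R.toMorphism.dom, R.toMorphism.toFun ⟨R.inverse x, h⟩ = x := by
  have : R.inverse x ∈ R.toMorphism.fiber (x : X) := by rw [R.fiber_eq]; rfl
  exact this

theorem inverse_toFun (R : BinaryRepresentation μ) (ω : R.toMorphism.dom)
    (h : R.toMorphism.toFun ω ∈ R.D) : R.inverse ⟨R.toMorphism.toFun ω, h⟩ = ω := by
  have h1 : (ω : ℕ → Bool) ∈ R.toMorphism.fiber (R.toMorphism.toFun ω) := ⟨ω.2, rfl⟩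
  rw [R.fiber_eq ⟨_, h⟩] at h1
  exact h1.symm

variable [BorelSpace X]

/-- The inverse of a binary representation, as a morphism. -/
def inverseMorphism (R : BinaryRepresentation μ) : Morphism μ R.measure where
  dom := R.D
  toFun := R.inverse
  isPiZeroTwo_dom := R.isPiZeroTwo_D
  measure_dom := R.measure_D
  computable := R.computable_inverse
  measure_preimage A hA := by
    have hD := R.isPiZeroTwo_D.measurableSet
    have hdom := R.toMorphism.isPiZeroTwo_dom.measurableSet
    have hcont := R.toMorphism.computable.continuous
    rw [R.toMorphism.measure_preimage _
      (measurableSet_subtype_preimage hD R.computable_inverse.continuous hA)]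
    -- Almost every `ω` is decoded into `D`, and there the inverse returns `ω` itself. The preimage
    -- of `A` under the round trip thus differs from `A` by a null set.
    have hfull : (R.measure : Measure (ℕ → Bool))
        {ω | ∃ h : ω ∈ R.toMorphism.dom, R.toMorphism.toFun ⟨ω, h⟩ ∈ R.D} = 1 := by
      rw [← R.toMorphism.measure_preimage _ hD, R.measure_D]
    have hae := (prob_compl_eq_zero_iff
      (measurableSet_subtype_preimage hdom hcont hD)).2 hfull
    refine measure_congr ?_
    filter_upwards [compl_mem_ae_iff.2 hae] with ω hω
    rw [compl_compl] at hω
    obtain ⟨h, hD⟩ := hω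
    refine propext ⟨fun hA => ⟨h, hD, ?_⟩, fun ⟨h', hD', hA⟩ => ?_⟩
    · rw [R.inverse_toFun ⟨ω, h⟩ hD]
      exact hA
    · rw [R.inverse_toFun ⟨ω, h'⟩ hD'] at hA
      exact hA

/-- A binary representation, together with its inverse, is an isomorphism. -/
def isomorphism (R : BinaryRepresentation μ) : Isomorphism R.measure μ where
  hom := R.toMorphism
  inv := R.inverseMorphism
  inv_hom := R.inverse_toFun
  hom_inv x _ := (R.exists_inverse_mem x).2

end BinaryRepresentation

end Isomorphisms

/-! ### Comparing scaled distances with dyadic intervals -/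

section Levels

variable {X : Type*} [MetricSpace X] [ComputableMetricSpace X]

/-- `Δ t (i, j)` approximates `2 ^ t * d(s i, s j)` with error at most `2`. -/
def IsDyadicDist (X : Type*) [MetricSpace X] [ComputableMetricSpace X] (Δ : ℕ → ℕ × ℕ → ℕ) : Prop :=
  ∀ t i j, |(Δ t (i, j) : ℝ) - 2 ^ t * dist (ComputableMetricSpace.ideal i : X)
    (ComputableMetricSpace.ideal j)| ≤ 2

/-- The distances between ideal points have computable dyadic approximations. -/
theorem exists_dyadic_dist (X : Type*) [MetricSpace X] [ComputableMetricSpace X] :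
    ∃ Δ : ℕ → ℕ × ℕ → ℕ, Computable₂ Δ ∧ IsDyadicDist X Δ := by
  obtain ⟨σ, hσ, hname⟩ := ComputableMetricSpace.dist_computable (X := X)
  -- Entry `t + 1` of the name has error at most `2 ^ (-t)`, which becomes `1` after scaling;
  -- integer division costs at most another `1`. Truncated subtraction replaces a negative
  -- approximation by `0`, which is no worse since distances are nonnegative.
  refine ⟨fun t q => 2 ^ t * ((σ q (t + 1)).unpair.1.unpair.1 - (σ q (t + 1)).unpair.1.unpair.2)
    / ((σ q (t + 1)).unpair.2 + 1), ?_, fun t i j => ?_⟩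
  · have h : Computable fun q : ℕ × ℕ × ℕ => σ q.2 (q.1 + 1) :=
      hσ.comp .snd (Computable.succ.comp .fst)
    have h1 := computable_unpair_fst h
    exact computable_div (computable_mul (computable_two_pow .fst)
      (computable_sub (computable_unpair_fst h1) (computable_unpair_snd h1)))
      (Computable.succ.comp (computable_unpair_snd h))
  · have h := (hname (i, j)).dist_le (t + 1)
    simp only at h ⊢
    generalize σ (i, j) (t + 1) = m at h ⊢
    rw [Real.dist_eq] at h
    set d := dist (ComputableMetricSpace.ideal i : X) (ComputableMetricSpace.ideal j) with hd
    have hd0 : 0 ≤ d := dist_nonneg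
    simp only [ratNum] at h
    push_cast at h
    generalize m.unpair.1.unpair.1 = a at h ⊢
    generalize m.unpair.1.unpair.2 = b at h ⊢
    generalize m.unpair.2 = c at h ⊢
    have hc : (0 : ℝ) < (c : ℝ) + 1 := by positivity
    have ht : (0 : ℝ) < 2 ^ t := by positivity
    have h2 : |2 ^ t * (((a : ℝ) - b) / (c + 1)) - 2 ^ t * d| ≤ 1 := by
      rw [← mul_sub, abs_mul, abs_of_pos ht]
      calc (2 : ℝ) ^ t * |((a : ℝ) - b) / (c + 1) - d| ≤ 2 ^ t * (2 / 2 ^ (t + 1)) := by gcongr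
        _ = 1 := by rw [pow_succ]; field_simp
    have hfl : ((2 ^ t * (a - b) / (c + 1) : ℕ) : ℝ) ≤ 2 ^ t * ((a - b : ℕ) : ℝ) / (c + 1) := by
      have := Nat.cast_div_le (α := ℝ) (m := 2 ^ t * (a - b)) (n := c + 1)
      push_cast at this
      exact this
    have hfl' : 2 ^ t * ((a - b : ℕ) : ℝ) / (c + 1) < ((2 ^ t * (a - b) / (c + 1) : ℕ) : ℝ) + 1 := by
      rw [div_lt_iff₀ hc]
      have := Nat.lt_mul_of_div_lt (Nat.lt_succ_self (2 ^ t * (a - b) / (c + 1))) (Nat.succ_pos c)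
      have h3 : ((2 ^ t * (a - b) : ℕ) : ℝ) < (((2 ^ t * (a - b) / (c + 1) + 1) * (c + 1) : ℕ) : ℝ) := by
        exact_mod_cast this
      push_cast at h3 ⊢
      linarith
    have hmax : ((a - b : ℕ) : ℝ) = max ((a : ℝ) - b) 0 := by
      rcases le_total b a with hab | hab
      · rw [Nat.cast_sub hab, max_eq_left (sub_nonneg.2 (by exact_mod_cast hab))]
      · rw [Nat.sub_eq_zero_of_le hab, max_eq_right (sub_nonpos.2 (by exact_mod_cast hab))]
        simp
    have h3 : |2 ^ t * ((a - b : ℕ) : ℝ) / (c + 1) - 2 ^ t * d| ≤ 1 := by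
      rw [hmax]
      rcases le_total ((a : ℝ) - b) 0 with hab | hab
      · rw [max_eq_right hab, mul_zero, zero_div, zero_sub, abs_neg, abs_of_nonneg (by positivity)]
        have : 2 ^ t * (((a : ℝ) - b) / (c + 1)) ≤ 0 :=
          mul_nonpos_of_nonneg_of_nonpos ht.le (div_nonpos_of_nonpos_of_nonneg hab hc.le)
        have := (abs_le.1 h2).1
        linarith
      · rw [max_eq_left hab, mul_div_assoc]
        exact h2
    rw [abs_le] at h3 ⊢
    constructor <;> linarith [h3.1, h3.2]

/-- The distance to the `i`-th ideal point scaled by `2 ^ k`, where `n = ⟨i, k⟩`. -/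
noncomputable def level (n : ℕ) (x : X) : ℝ :=
  2 ^ n.unpair.2 * dist (ComputableMetricSpace.ideal n.unpair.1) x

theorem abs_level_sub_le (n : ℕ) (x y : X) :
    |level n x - level n y| ≤ 2 ^ n.unpair.2 * dist x y := by
  unfold level
  rw [← mul_sub, abs_mul, abs_of_pos (by positivity : (0 : ℝ) < 2 ^ n.unpair.2)]
  gcongr
  rw [dist_comm _ x, dist_comm _ y]
  exact abs_dist_sub_le _ _ _

theorem continuous_level (n : ℕ) : Continuous (level n : X → ℝ) :=
  continuous_const.mul (continuous_const.dist continuous_id)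

/-- `β` lies in the dyadic interval `[a / 2 ^ p, (a + 1) / 2 ^ p]` with code `(p, a)`. -/
def MemDyadic (β : ℝ) (I : ℕ × ℕ) : Prop := (I.2 : ℝ) ≤ β * 2 ^ I.1 ∧ β * 2 ^ I.1 ≤ I.2 + 1

/-- The approximation at precision `t` of the `n`-th level of the `j`-th ideal point lies to the left
of a dyadic interval. -/
def below (Δ : ℕ → ℕ × ℕ → ℕ) (t n j : ℕ) (I : ℕ × ℕ) : Bool :=
  decide (2 ^ n.unpair.2 * Δ t (n.unpair.1, j) * 2 ^ I.1 < I.2 * 2 ^ t)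

/-- The `n`-th level of the `j`-th ideal point is seen at precision `t` to be away from a dyadic
interval. -/
def far (Δ : ℕ → ℕ × ℕ → ℕ) (t n j : ℕ) (I : ℕ × ℕ) : Bool :=
  decide (7 * (2 ^ n.unpair.2 * 2 ^ I.1) + 2 ^ t + I.2 * 2 ^ t
      < 2 ^ n.unpair.2 * Δ t (n.unpair.1, j) * 2 ^ I.1) ||
    decide (7 * (2 ^ n.unpair.2 * 2 ^ I.1) + 2 ^ t
      + 2 ^ n.unpair.2 * Δ t (n.unpair.1, j) * 2 ^ I.1 < I.2 * 2 ^ t)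

/-- All levels up to the `n`-th one are seen to be away from a dyadic interval. -/
def separated (Δ : ℕ → ℕ × ℕ → ℕ) (t n j : ℕ) (I : ℕ × ℕ) : Bool :=
  allLT (fun i => far Δ t i j I) (n + 1)

/-- The number whose first `n + 1` binary digits tell which levels lie to the left of a dyadic
interval. -/
def digits (Δ : ℕ → ℕ × ℕ → ℕ) (t n j : ℕ) (I : ℕ × ℕ) : ℕ :=
  bitsLT (fun i => below Δ t i j I) (n + 1)

theorem separated_eq_true {Δ : ℕ → ℕ × ℕ → ℕ} {t n j : ℕ} {I : ℕ × ℕ} :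
    separated Δ t n j I = true ↔ ∀ i ≤ n, far Δ t i j I = true := by
  simp [separated, allLT_eq_true]

theorem testBit_digits (Δ : ℕ → ℕ × ℕ → ℕ) (t : ℕ) {n i : ℕ} (j : ℕ) (I : ℕ × ℕ) (h : i ≤ n) :
    (digits Δ t n j I).testBit i = below Δ t i j I :=
  testBit_bitsLT _ (Nat.lt_succ_of_le h)

section Computability

variable {α : Type*} [Primcodable α] {Δ : ℕ → ℕ × ℕ → ℕ} {t n j : α → ℕ} {I : α → ℕ × ℕ}

theorem computable_scaled (hΔ : Computable₂ Δ) (ht : Computable t) (hn : Computable n)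
    (hj : Computable j) (hI : Computable I) : Computable fun a =>
      2 ^ (n a).unpair.2 * Δ (t a) ((n a).unpair.1, j a) * 2 ^ (I a).1 :=
  computable_mul (computable_mul (computable_two_pow (computable_unpair_snd hn))
    (hΔ.comp ht (Computable.pair (computable_unpair_fst hn) hj)))
    (computable_two_pow (Computable.fst.comp hI))

theorem computable_below (hΔ : Computable₂ Δ) (ht : Computable t) (hn : Computable n)
    (hj : Computable j) (hI : Computable I) :
    Computable fun a => below Δ (t a) (n a) (j a) (I a) :=
  computable_decide_lt (computable_scaled hΔ ht hn hj hI)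
    (computable_mul (Computable.snd.comp hI) (computable_two_pow ht))

theorem computable_far (hΔ : Computable₂ Δ) (ht : Computable t) (hn : Computable n)
    (hj : Computable j) (hI : Computable I) :
    Computable fun a => far Δ (t a) (n a) (j a) (I a) := by
  have h1 := computable_scaled hΔ ht hn hj hI
  have h2 : Computable fun a => 7 * (2 ^ (n a).unpair.2 * 2 ^ (I a).1) + 2 ^ t a :=
    computable_add (computable_mul (.const 7) (computable_mul
      (computable_two_pow (computable_unpair_snd hn)) (computable_two_pow (Computable.fst.comp hI))))
      (computable_two_pow ht)
  have h3 : Computable fun a => (I a).2 * 2 ^ t a :=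
    computable_mul (Computable.snd.comp hI) (computable_two_pow ht)
  exact computable_or (computable_decide_lt (computable_add h2 h3) h1)
    (computable_decide_lt (computable_add h2 h1) h3)

theorem computable_separated (hΔ : Computable₂ Δ) (ht : Computable t) (hn : Computable n)
    (hj : Computable j) (hI : Computable I) :
    Computable fun a => separated Δ (t a) (n a) (j a) (I a) :=
  computable_allLT (p := fun a i => far Δ (t a) i (j a) (I a))
    (computable_far hΔ (ht.comp .fst) .snd (hj.comp .fst) (hI.comp .fst)) (Computable.succ.comp hn)

theorem computable_digits (hΔ : Computable₂ Δ) (ht : Computable t) (hn : Computable n)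
    (hj : Computable j) (hI : Computable I) :
    Computable fun a => digits Δ (t a) (n a) (j a) (I a) :=
  computable_bitsLT (p := fun a i => below Δ (t a) i (j a) (I a))
    (computable_below hΔ (ht.comp .fst) .snd (hj.comp .fst) (hI.comp .fst)) (Computable.succ.comp hn)

end Computability

theorem abs_scaled_sub_le {Δ : ℕ → ℕ × ℕ → ℕ} (hΔ : IsDyadicDist X Δ) (t n j p : ℕ) :
    |((2 ^ n.unpair.2 * Δ t (n.unpair.1, j) * 2 ^ p : ℕ) : ℝ)
      - level n (ComputableMetricSpace.ideal j : X) * (2 ^ t * 2 ^ p)|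
        ≤ 2 * (2 ^ n.unpair.2 * 2 ^ p) := by
  have h := hΔ t n.unpair.1 j
  have h1 : ((2 ^ n.unpair.2 * Δ t (n.unpair.1, j) * 2 ^ p : ℕ) : ℝ)
      - level n (ComputableMetricSpace.ideal j : X) * (2 ^ t * 2 ^ p)
      = (2 ^ n.unpair.2 * 2 ^ p) * ((Δ t (n.unpair.1, j) : ℝ) - 2 ^ t *
        dist (ComputableMetricSpace.ideal n.unpair.1 : X) (ComputableMetricSpace.ideal j)) := by
    unfold level
    push_cast
    ring
  rw [h1, abs_mul, abs_of_pos (by positivity : (0 : ℝ) < 2 ^ n.unpair.2 * 2 ^ p), mul_comm]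
  gcongr

/-- If a level of an ideal point is seen to be far from an interval, then nearby points lie on the
same side of each element of the interval. -/
theorem far_spec {Δ : ℕ → ℕ × ℕ → ℕ} (hΔ : IsDyadicDist X Δ) {t n j : ℕ}
    {I : ℕ × ℕ} {β : ℝ} (hβ : MemDyadic β I)
    (h : far Δ t n j I = true) {x : X}
    (hx : dist (ComputableMetricSpace.ideal j) x ≤ 4 / 2 ^ t) :
    level n x ≠ β ∧ below Δ t n j I = decide (level n x < β) := by
  -- Everything is multiplied by `2 ^ t * 2 ^ I.1`. In units of `2 ^ n.unpair.2 * 2 ^ I.1`, the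
  -- error of `Δ` contributes `2` and the displacement from the ideal point to `x` contributes `4`;
  -- the margin `7` in `far` covers both.
  have h1 := abs_scaled_sub_le hΔ t n j I.1
  have h2 := (abs_level_sub_le n (ComputableMetricSpace.ideal j : X) x).trans
    (mul_le_mul_of_nonneg_left hx (by positivity))
  have ht : (0 : ℝ) < 2 ^ t := by positivity
  have hp : (0 : ℝ) < 2 ^ I.1 := by positivity
  have hk : (0 : ℝ) < 2 ^ n.unpair.2 * 2 ^ I.1 := by positivity
  have h3 : |level n (ComputableMetricSpace.ideal j : X) * (2 ^ t * 2 ^ I.1)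
      - level n x * (2 ^ t * 2 ^ I.1)| ≤ 4 * (2 ^ n.unpair.2 * 2 ^ I.1) := by
    rw [← sub_mul, abs_mul, abs_of_pos (mul_pos ht hp)]
    refine (mul_le_mul_of_nonneg_right h2 (by positivity)).trans_eq ?_
    field_simp
  have hlo : (I.2 : ℝ) * 2 ^ t ≤ β * (2 ^ t * 2 ^ I.1) := by nlinarith [hβ.1]
  have hhi : β * (2 ^ t * 2 ^ I.1) ≤ (I.2 : ℝ) * 2 ^ t + 2 ^ t := by nlinarith [hβ.2]
  rw [abs_le] at h1 h3
  unfold far at h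
  rw [Bool.or_eq_true, decide_eq_true_eq, decide_eq_true_eq] at h
  unfold below
  set v := 2 ^ n.unpair.2 * Δ t (n.unpair.1, j) * 2 ^ I.1 with hv
  rcases h with h | h
  · have h' : 7 * (2 ^ n.unpair.2 * 2 ^ I.1) + 2 ^ t + (I.2 : ℝ) * 2 ^ t < (v : ℝ) := by
      exact_mod_cast h
    have hlt : β < level n x :=
      lt_of_mul_lt_mul_right (a := 2 ^ t * 2 ^ I.1) (by linarith [h1.2, h3.2]) (by positivity)
    refine ⟨hlt.ne', ?_⟩
    rw [decide_eq_false (not_lt.2 hlt.le), decide_eq_false]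
    have := Nat.two_pow_pos t
    omega
  · have h' : 7 * (2 ^ n.unpair.2 * 2 ^ I.1) + 2 ^ t + (v : ℝ) < (I.2 : ℝ) * 2 ^ t := by
      exact_mod_cast h
    have hlt : level n x < β :=
      lt_of_mul_lt_mul_right (a := 2 ^ t * 2 ^ I.1) (by linarith [h1.1, h3.1]) (by positivity)
    refine ⟨hlt.ne, ?_⟩
    rw [decide_eq_true hlt, decide_eq_true]
    have := Nat.two_pow_pos t
    omega

/-- This is the counterpart of `far_spec`: a failed test pins the level near `β`. The `9` is the
margin `7` of the test plus the error `2` of `Δ`; the last term is the slack `2 ^ t` of the test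
plus the width of the interval. -/
theorem abs_level_sub_le_of_not_far {Δ : ℕ → ℕ × ℕ → ℕ} (hΔ : IsDyadicDist X Δ) {t n j : ℕ}
    {I : ℕ × ℕ} {β : ℝ} (hβ : MemDyadic β I)
    (h : far Δ t n j I = false) :
    |level n (ComputableMetricSpace.ideal j : X) - β| ≤ 9 * 2 ^ n.unpair.2 / 2 ^ t + 2 / 2 ^ I.1 := by
  have h1 := abs_scaled_sub_le hΔ t n j I.1
  have ht : (0 : ℝ) < 2 ^ t := by positivity
  have hp : (0 : ℝ) < 2 ^ I.1 := by positivity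
  have hlo : (I.2 : ℝ) * 2 ^ t ≤ β * (2 ^ t * 2 ^ I.1) := by nlinarith [hβ.1]
  have hhi : β * (2 ^ t * 2 ^ I.1) ≤ (I.2 : ℝ) * 2 ^ t + 2 ^ t := by nlinarith [hβ.2]
  unfold far at h
  rw [Bool.or_eq_false_iff, decide_eq_false_iff_not, decide_eq_false_iff_not, not_lt, not_lt] at h
  set v := 2 ^ n.unpair.2 * Δ t (n.unpair.1, j) * 2 ^ I.1 with hv
  have h2 : (v : ℝ) ≤ 7 * (2 ^ n.unpair.2 * 2 ^ I.1) + 2 ^ t + (I.2 : ℝ) * 2 ^ t := by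
    exact_mod_cast h.1
  have h3 : (I.2 : ℝ) * 2 ^ t ≤ 7 * (2 ^ n.unpair.2 * 2 ^ I.1) + 2 ^ t + (v : ℝ) := by
    exact_mod_cast h.2
  rw [abs_le] at h1
  refine le_of_mul_le_mul_right (a := 2 ^ t * 2 ^ I.1) ?_ (by positivity)
  have h4 : (9 * 2 ^ n.unpair.2 / 2 ^ t + 2 / 2 ^ I.1) * (2 ^ t * 2 ^ I.1 : ℝ)
      = 9 * (2 ^ n.unpair.2 * 2 ^ I.1) + 2 * 2 ^ t := by
    field_simp
  rw [h4, ← abs_of_pos (mul_pos ht hp), ← abs_mul, sub_mul, abs_le]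
  constructor <;> linarith [h1.1, h1.2]

end Levels

/-! ### Ideal measures -/

section IdealMeasures

/-- The list of weighted atoms of the `n`-th ideal measure. -/
def atoms (n : ℕ) : List (ℕ × ℕ) :=
  (Denumerable.ofNat ((ℕ × ℕ) × List (ℕ × ℕ)) n).1 ::
    (Denumerable.ofNat ((ℕ × ℕ) × List (ℕ × ℕ)) n).2

/-- The total weight of the entries of a list of weighted atoms that satisfy `b`. -/
def weight (b : ℕ → Bool) (l : List (ℕ × ℕ)) : ℕ :=
  (l.map fun q => bif b q.1 then q.2 + 1 else 0).sum

theorem weight_cons (b : ℕ → Bool) (q : ℕ × ℕ) (l : List (ℕ × ℕ)) :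
    weight b (q :: l) = (bif b q.1 then q.2 + 1 else 0) + weight b l := by
  simp [weight]

theorem weight_true_pos (n : ℕ) : 0 < weight (fun _ => true) (atoms n) := by
  rw [atoms, weight_cons, cond_true]
  omega

theorem weight_mono_or {b c d : ℕ → Bool} (h : ∀ j, b j = true → c j = true ∨ d j = true)
    (l : List (ℕ × ℕ)) : weight b l ≤ weight c l + weight d l := by
  induction l with
  | nil => simp [weight]
  | cons q l ih =>
    simp only [weight_cons]
    have := h q.1
    cases hb : b q.1 <;> cases hc : c q.1 <;> cases hd : d q.1 <;> simp_all <;> omega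

theorem computable_ofNat_atoms :
    Computable (Denumerable.ofNat ((ℕ × ℕ) × List (ℕ × ℕ))) := by
  refine (Computable.option_getD (Computable.decode (α := (ℕ × ℕ) × List (ℕ × ℕ)))
    (.const ((0, 0), []))).of_eq fun n => ?_
  rw [Denumerable.decode_eq_ofNat]
  rfl

theorem computable_atoms : Computable atoms :=
  Computable.list_cons.comp (Computable.fst.comp computable_ofNat_atoms)
    (Computable.snd.comp computable_ofNat_atoms)

theorem computable_weight {α : Type*} [Primcodable α] {b : α → ℕ → Bool} {l : α → List (ℕ × ℕ)}
    (hb : Computable₂ b) (hl : Computable l) : Computable fun a => weight (b a) (l a) := by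
  refine computable_list_sum (computable_list_map (g := fun a q => bif b a q.1 then q.2 + 1 else 0)
    hl ?_)
  exact Computable.cond (hb.comp .fst (Computable.fst.comp .snd))
    (Computable.succ.comp (Computable.snd.comp .snd)) (.const 0)

variable {X : Type*} [MeasurableSpace X]

theorem weightedSum_cons (s : ℕ → X) (q : ℕ × ℕ) (l : List (ℕ × ℕ)) :
    weightedSum s (q :: l) = ((q.2 + 1 : ℕ) : ℝ≥0∞) • Measure.dirac (s q.1) + weightedSum s l := by
  simp [weightedSum]

/-- Here and in the reverse bound only one implication between membership and `b` is needed, so a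
decidable test can stand in for a set whose membership is undecidable. -/
theorem weightedSum_le_weight (s : ℕ → X) {A : Set X} (hA : MeasurableSet A) {b : ℕ → Bool}
    (h : ∀ j, s j ∈ A → b j = true) (l : List (ℕ × ℕ)) :
    weightedSum s l A ≤ (weight b l : ℝ≥0∞) := by
  induction l with
  | nil => simp [weightedSum]
  | cons q l ih =>
    rw [weightedSum_cons, weight_cons, Measure.add_apply,
      Nat.cast_add (bif b q.1 then q.2 + 1 else 0), Measure.smul_apply,
      Measure.dirac_apply' _ hA, smul_eq_mul]
    refine add_le_add ?_ ih
    by_cases hq : s q.1 ∈ A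
    · simp [hq, h _ hq]
    · simp [hq]

theorem weight_le_weightedSum (s : ℕ → X) {A : Set X} {b : ℕ → Bool}
    (h : ∀ j, b j = true → s j ∈ A) (l : List (ℕ × ℕ)) :
    (weight b l : ℝ≥0∞) ≤ weightedSum s l A := by
  induction l with
  | nil => simp [weightedSum, weight]
  | cons q l ih =>
    rw [weightedSum_cons, weight_cons, Measure.add_apply, Nat.cast_add, Measure.smul_apply,
      smul_eq_mul]
    refine add_le_add ?_ ih
    cases hq : b q.1
    · simp
    · rw [Measure.dirac_apply_of_mem (h _ hq)]
      simp

theorem idealMeasure_apply (s : ℕ → X) (n : ℕ) (A : Set X) :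
    (idealMeasure s n : Measure X) A
      = (weight (fun _ => true) (atoms n) : ℝ≥0∞)⁻¹ * weightedSum s (atoms n) A := by
  have : weightedSum s (atoms n) Set.univ = (weight (fun _ => true) (atoms n) : ℝ≥0∞) := by
    rw [weightedSum_univ]
    simp [weight]
  rw [← this]
  rfl

theorem idealMeasure_real_le (s : ℕ → X) (n : ℕ) {A : Set X} (hA : MeasurableSet A) {b : ℕ → Bool}
    (h : ∀ j, s j ∈ A → b j = true) : (idealMeasure s n : Measure X).real A
      ≤ (weight b (atoms n) : ℝ) / weight (fun _ => true) (atoms n) := by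
  rw [measureReal_def, idealMeasure_apply]
  refine ENNReal.toReal_le_of_le_ofReal (by positivity) ?_
  rw [ENNReal.ofReal_div_of_pos (by exact_mod_cast weight_true_pos n), ENNReal.ofReal_natCast,
    ENNReal.ofReal_natCast, mul_comm, ENNReal.div_eq_inv_mul, mul_comm]
  gcongr
  exact weightedSum_le_weight s hA h _

theorem le_idealMeasure_real (s : ℕ → X) (n : ℕ) {A : Set X} {b : ℕ → Bool}
    (h : ∀ j, b j = true → s j ∈ A) : (weight b (atoms n) : ℝ) / weight (fun _ => true) (atoms n)
      ≤ (idealMeasure s n : Measure X).real A := by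
  rw [measureReal_def, ← ENNReal.ofReal_le_iff_le_toReal (measure_ne_top _ _), idealMeasure_apply,
    ENNReal.ofReal_div_of_pos (by exact_mod_cast weight_true_pos n), ENNReal.ofReal_natCast,
    ENNReal.ofReal_natCast, ENNReal.div_eq_inv_mul]
  gcongr
  exact weight_le_weightedSum s h _

theorem measureReal_le_of_dist_lt {X : Type*} [MetricSpace X] [MeasurableSpace X] [BorelSpace X]
    {μ ν : ProbabilityMeasure X} {c : ℝ}
    (h : dist (LevyProkhorov.ofMeasure μ) (LevyProkhorov.ofMeasure ν) < c) {A : Set X}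
    (hA : MeasurableSet A) :
    (μ : Measure X).real A ≤ (ν : Measure X).real (Metric.thickening c A) + c := by
  have hc : 0 < c := dist_nonneg.trans_lt h
  have h1 : levyProkhorovEDist (μ : Measure X) (ν : Measure X) < ENNReal.ofReal c := by
    rw [← edist_lt_ofReal, LevyProkhorov.edist_probabilityMeasure_def] at h
    exact h
  have h2 := left_measure_le_of_levyProkhorovEDist_lt h1 hA
  rw [ENNReal.toReal_ofReal hc.le] at h2
  have h3 := ENNReal.toReal_mono (by finiteness) h2
  rwa [ENNReal.toReal_add (by finiteness) (by finiteness), ENNReal.toReal_ofReal hc.le] at h3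

end IdealMeasures

/-! ### The threshold -/

section Threshold

variable {X : Type*} [MetricSpace X] [ComputableMetricSpace X] [MeasurableSpace X] [BorelSpace X]

/-- The dyadic interval `I` is admissible at stage `n` and precision `t`: the first ideal points are
separated from it, and so are all but a fraction `2 ^ (-n)` of the atoms of an ideal measure. -/
def admissible (Δ : ℕ → ℕ × ℕ → ℕ) (σ : ℕ → ℕ) (n t : ℕ) (I : ℕ × ℕ) : Bool :=
  decide (n ≤ t) && (allLT (fun j => separated Δ t n j I) (n + 1) &&
    decide (weight (fun j => !separated Δ t n j I) (atoms (σ t)) * 2 ^ n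
      ≤ weight (fun _ => true) (atoms (σ t))))

theorem computable_admissible {α : Type*} [Primcodable α] {Δ : ℕ → ℕ × ℕ → ℕ} {σ : ℕ → ℕ}
    {t n : α → ℕ} {I : α → ℕ × ℕ} (hΔ : Computable₂ Δ) (hσ : Computable σ) (hn : Computable n)
    (ht : Computable t) (hI : Computable I) :
    Computable fun a => admissible Δ σ (n a) (t a) (I a) := by
  have hl : Computable fun a => atoms (σ (t a)) := computable_atoms.comp (hσ.comp ht)
  have hs : Computable₂ fun a j => separated Δ (t a) (n a) j (I a) :=
    computable_separated hΔ (ht.comp .fst) (hn.comp .fst) .snd (hI.comp .fst)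
  refine computable_and (computable_decide_le hn ht) (computable_and
    (computable_allLT hs (Computable.succ.comp hn)) (computable_decide_le (computable_mul
      (computable_weight (b := fun a j => !separated Δ (t a) (n a) j (I a)) (computable_not hs) hl)
      (computable_two_pow hn)) (computable_weight (.const true) hl)))

/-- For each level only countably many values are taken with positive measure, and countably many at
ideal points. This `β` need not be computable: it only serves to show that a search terminates. -/
theorem exists_null_level (μ : ProbabilityMeasure X) {a b : ℝ} (hab : a < b) :
    ∃ β, a < β ∧ β < b ∧ (∀ i, (μ : Measure X) {x | level i x = β} = 0) ∧
      ∀ i j, level i (ComputableMetricSpace.ideal j : X) ≠ β := by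
  have hc : (⋃ i, {β : ℝ | 0 < (μ : Measure X) {x | level i x = β}} ∪
      Set.range fun j => level i (ComputableMetricSpace.ideal j : X)).Countable :=
    Set.countable_iUnion fun i => (Measure.countable_meas_level_set_pos
      (continuous_level i).measurable).union (Set.countable_range _)
  obtain ⟨β, hβ, hβ'⟩ := (hc.dense_compl ℝ).exists_between hab
  simp only [Set.mem_compl_iff, Set.mem_iUnion, Set.mem_union, not_exists, not_or] at hβ
  refine ⟨β, hβ'.1, hβ'.2, fun i => ?_, fun i j h => (hβ i).2 ⟨j, h⟩⟩
  have := (hβ i).1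
  simpa using this

/-- Continuity of the measure from above along closed strips shrinking to the level set. -/
theorem tendsto_measure_abs_sub_le {X : Type*} [TopologicalSpace X] [MeasurableSpace X]
    [OpensMeasurableSpace X] (μ : ProbabilityMeasure X) {f : X → ℝ} (hf : Continuous f)
    {β : ℝ} (h : (μ : Measure X) {x | f x = β} = 0) :
    Tendsto (fun m : ℕ => (μ : Measure X).real {x | |f x - β| ≤ (1 / 2) ^ m}) atTop (𝓝 0) := by
  have hpow : Tendsto (fun m : ℕ => (1 / 2 : ℝ) ^ m) atTop (𝓝 0) :=
    tendsto_pow_atTop_nhds_zero_of_lt_one (by norm_num) (by norm_num)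
  have hset : ⋂ m : ℕ, {x | |f x - β| ≤ (1 / 2) ^ m} = {x | f x = β} := by
    ext x
    simp only [Set.mem_iInter]
    constructor
    · intro hx
      have := ge_of_tendsto' hpow hx
      exact sub_eq_zero.1 (abs_nonpos_iff.1 this)
    · intro hx m
      have hx : f x = β := hx
      show |f x - β| ≤ _
      rw [hx, sub_self, abs_zero]
      positivity
  have h1 := tendsto_measure_iInter_atTop (μ := (μ : Measure X))
    (s := fun m : ℕ => {x | |f x - β| ≤ (1 / 2) ^ m})
    (fun m => (isClosed_le (by fun_prop) continuous_const).measurableSet.nullMeasurableSet)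
    (fun m k hmk x (hx : |f x - β| ≤ (1 / 2) ^ k) => show |f x - β| ≤ (1 / 2) ^ m from
      hx.trans (pow_le_pow_of_le_one (by norm_num) (by norm_num) hmk))
    ⟨0, measure_ne_top _ _⟩
  rw [hset, h] at h1
  exact (ENNReal.tendsto_toReal ENNReal.zero_ne_top).comp h1

/-- The search for the next interval succeeds; the condition on `a'` says that the new interval is
nested in the old one. Take a null value `β` inside the old interval and a short dyadic interval
around it. Atoms not separated from that interval lie in thin strips around the level sets of `β`;
these have small `μ`-measure, and Prokhorov closeness transfers the bound to the ideal measure. -/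
theorem exists_admissible {Δ : ℕ → ℕ × ℕ → ℕ} (hΔ : IsDyadicDist X Δ) {μ : ProbabilityMeasure X}
    {σ : ℕ → ℕ} (hσ : CauchyName (fun n => LevyProkhorov.ofMeasure
      (idealMeasure (ComputableMetricSpace.ideal : ℕ → X) n)) σ (LevyProkhorov.ofMeasure μ))
    (n p a : ℕ) : ∃ p' a' t, p < p' ∧ a' / 2 ^ (p' - p) = a ∧
      admissible Δ σ n t (p', a') = true := by
  have hp0 : (0 : ℝ) < 2 ^ p := by positivity
  obtain ⟨β, haβ, hβb, hnull, hideal⟩ := exists_null_level μ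
    (show (a : ℝ) / 2 ^ p < (a + 1) / 2 ^ p by gcongr; linarith)
  rw [div_lt_iff₀ hp0] at haβ
  rw [lt_div_iff₀ hp0] at hβb
  have hβ0 : 0 ≤ β := by
    by_contra h
    have : β * 2 ^ p ≤ 0 := mul_nonpos_of_nonpos_of_nonneg (not_le.1 h).le hp0.le
    have : (0 : ℝ) ≤ a := by positivity
    linarith
  have hpow : Tendsto (fun m : ℕ => (1 / 2 : ℝ) ^ m) atTop (𝓝 0) :=
    tendsto_pow_atTop_nhds_zero_of_lt_one (by norm_num) (by norm_num)
  have hsum : Tendsto (fun m : ℕ => ∑ i ∈ Finset.range (n + 1),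
      (μ : Measure X).real {x | |level i x - β| ≤ (1 / 2) ^ m}) atTop (𝓝 0) := by
    simpa using tendsto_finsetSum (Finset.range (n + 1)) fun i _ =>
      tendsto_measure_abs_sub_le μ (continuous_level i) (hnull i)
  have hev : ∀ᶠ m : ℕ in atTop, ∀ i ∈ Finset.range (n + 1), ∀ j ∈ Finset.range (n + 1),
      (1 / 2 : ℝ) ^ m < |level i (ComputableMetricSpace.ideal j : X) - β| :=
    (eventually_all_finset _).2 fun i _ => (eventually_all_finset _).2 fun j _ =>
      hpow.eventually_lt_const (abs_pos.2 (sub_ne_zero.2 (hideal i j)))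
  obtain ⟨m, hm1, hm2⟩ := (hev.and (hsum.eventually_lt_const
    (show (0 : ℝ) < (1 / 2) ^ n / 2 by positivity))).exists
  set δ : ℝ := (1 / 2) ^ m with hδ
  have hδ0 : 0 < δ := by positivity
  have hδ1 : δ ≤ 1 := pow_le_one₀ (by norm_num) (by norm_num)
  -- With `p' ≥ m + 3` and `t = m + n + 6`, an unseparated ideal point has a level within `9δ/64 +
  -- δ/4 ≤ δ/2` of `β`. Thickening by `4 / 2 ^ t` moves a level by at most `δ/16`, so it stays in
  -- the strip of half-width `δ`. The additive Prokhorov error `4 / 2 ^ t` is at most half of `2 ^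
  -- (-n)`, the other half being the measure of the strips.
  obtain ⟨p', hpp', hmp'⟩ : ∃ p', p < p' ∧ m + 3 ≤ p' := ⟨p + m + 3, by omega, by omega⟩
  set t := m + n + 6 with ht
  have hβI : MemDyadic β (p', ⌊β * 2 ^ p'⌋₊) :=
    ⟨Nat.floor_le (by positivity), (Nat.lt_floor_add_one _).le⟩
  have hp2 : (2 : ℝ) / 2 ^ p' ≤ δ / 4 := by
    have : (1 / 2 : ℝ) ^ p' ≤ (1 / 2) ^ (m + 3) :=
      pow_le_pow_of_le_one (by norm_num) (by norm_num) hmp'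
    rw [pow_add, ← hδ, one_div_pow (2 : ℝ) p'] at this
    have h2 : (2 : ℝ) / 2 ^ p' = 2 * (1 / 2 ^ p') := by ring
    rw [h2]
    linarith
  have hti : ∀ i ≤ n, (2 : ℝ) ^ i.unpair.2 / 2 ^ t ≤ δ / 64 := fun i hi => by
    have h1 : (2 : ℝ) ^ i.unpair.2 ≤ 2 ^ n :=
      pow_le_pow_right₀ (by norm_num) ((Nat.unpair_right_le i).trans hi)
    calc (2 : ℝ) ^ i.unpair.2 / 2 ^ t ≤ 2 ^ n / 2 ^ t := by gcongr
      _ = δ / 64 := by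
        rw [ht, hδ, pow_add, pow_add, one_div_pow]
        field_simp
        norm_num
  have ht4 : (4 : ℝ) / 2 ^ t ≤ (1 / 2) ^ n / 2 := by
    have : (4 : ℝ) / 2 ^ t = (1 / 2) ^ n * δ / 16 := by
      rw [ht, hδ, pow_add, pow_add, one_div_pow, one_div_pow]
      field_simp
      norm_num
    rw [this]
    have h0 : (0 : ℝ) < (1 / 2) ^ n := by positivity
    nlinarith
  have hbad : ∀ j, separated Δ t n j (p', ⌊β * 2 ^ p'⌋₊) = false → ∃ i ∈ Finset.range (n + 1),
      |level i (ComputableMetricSpace.ideal j : X) - β| ≤ δ / 2 := by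
    intro j hj
    have : ¬ ∀ i ≤ n, far Δ t i j (p', ⌊β * 2 ^ p'⌋₊) = true := by
      rw [← separated_eq_true, hj]
      simp
    push Not at this
    obtain ⟨i, hi, hfar⟩ := this
    have h1 := abs_level_sub_le_of_not_far hΔ hβI (Bool.eq_false_of_not_eq_true hfar)
    have h2 := hti i hi
    refine ⟨i, Finset.mem_range.2 (by omega), h1.trans ?_⟩
    rw [mul_div_assoc]
    simp only
    linarith
  refine ⟨p', ⌊β * 2 ^ p'⌋₊, t, hpp', ?_, ?_⟩
  · rw [← Nat.cast_ofNat (R := ℝ), ← Nat.floor_div_natCast]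
    have h1 : β * ((2 : ℕ) : ℝ) ^ p' / ((2 ^ (p' - p) : ℕ) : ℝ) = β * 2 ^ p := by
      obtain ⟨d, rfl⟩ := Nat.exists_eq_add_of_le hpp'.le
      rw [Nat.cast_pow, Nat.cast_ofNat, Nat.add_sub_cancel_left, pow_add, ← mul_assoc,
        mul_div_cancel_right₀ _ (by positivity)]
    rw [h1, Nat.floor_eq_iff (by positivity)]
    exact ⟨haβ.le, hβb⟩
  · simp only [admissible, Bool.and_eq_true, decide_eq_true_eq, allLT_eq_true]
    refine ⟨by omega, fun j hj => ?_, ?_⟩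
    · by_contra hsep
      obtain ⟨i, hi, h⟩ := hbad j (Bool.eq_false_of_not_eq_true hsep)
      have := hm1 i hi j (Finset.mem_range.2 hj)
      linarith
    · set A : Set X := ⋃ i ∈ Finset.range (n + 1), {x | |level i x - β| ≤ δ / 2} with hA
      have hAm : MeasurableSet A := Finset.measurableSet_biUnion _ fun i _ =>
        (isClosed_le (((continuous_level i).sub continuous_const).abs)
          continuous_const).measurableSet
      have h1 := le_idealMeasure_real (ComputableMetricSpace.ideal : ℕ → X) (σ t) (A := A)
        (b := fun j => !separated Δ t n j (p', ⌊β * 2 ^ p'⌋₊)) fun j hj => by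
          obtain ⟨i, hi, h⟩ := hbad j (by simpa using hj)
          exact Set.mem_biUnion hi h
      have hdist : dist (LevyProkhorov.ofMeasure (idealMeasure (ComputableMetricSpace.ideal : ℕ → X)
          (σ t))) (LevyProkhorov.ofMeasure μ) < 4 / 2 ^ t :=
        (hσ.dist_le t).trans_lt (by gcongr; norm_num)
      have h2 := measureReal_le_of_dist_lt hdist hAm
      have h3 : Metric.thickening (4 / 2 ^ t) A
          ⊆ ⋃ i ∈ Finset.range (n + 1), {x | |level i x - β| ≤ δ} := by
        intro x hx
        obtain ⟨y, hy, hxy⟩ := Metric.mem_thickening_iff.1 hx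
        obtain ⟨i, hi, hiy⟩ := Set.mem_iUnion₂.1 hy
        refine Set.mem_biUnion hi ?_
        have hiy : |level i y - β| ≤ δ / 2 := hiy
        have h4 := abs_level_sub_le i x y
        have h5 : (2 : ℝ) ^ i.unpair.2 * dist x y ≤ 2 ^ i.unpair.2 * (4 / 2 ^ t) := by gcongr
        have h6 := hti i (by simpa [Nat.lt_succ_iff] using hi)
        have h7 : (2 : ℝ) ^ i.unpair.2 * (4 / 2 ^ t) = 4 * (2 ^ i.unpair.2 / 2 ^ t) := by ring
        have h8 := abs_sub_le (level i x) (level i y) β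
        show |level i x - β| ≤ δ
        linarith
      have h4 := (measureReal_mono (μ := (μ : Measure X)) h3 (measure_ne_top _ _)).trans
        (measureReal_biUnion_finset_le _ _)
      have hpos : (0 : ℝ) < weight (fun _ => true) (atoms (σ t)) := by
        exact_mod_cast weight_true_pos _
      have h5 : (weight (fun j => !separated Δ t n j (p', ⌊β * 2 ^ p'⌋₊)) (atoms (σ t)) : ℝ)
          / weight (fun _ => true) (atoms (σ t)) ≤ (1 / 2) ^ n := by linarith
      rw [div_le_iff₀ hpos, one_div_pow, one_div, inv_mul_eq_div, le_div_iff₀ (by positivity)] at h5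
      exact_mod_cast h5

/-- The threshold: a number `α` with computable approximations by admissible dyadic intervals. -/
theorem exists_threshold {Δ : ℕ → ℕ × ℕ → ℕ} (hΔc : Computable₂ Δ) (hΔ : IsDyadicDist X Δ)
    {μ : ProbabilityMeasure X} {σ : ℕ → ℕ} (hσc : Computable σ)
    (hσ : CauchyName (fun n => LevyProkhorov.ofMeasure
      (idealMeasure (ComputableMetricSpace.ideal : ℕ → X) n)) σ (LevyProkhorov.ofMeasure μ)) :
    ∃ (I : ℕ → ℕ × ℕ) (T : ℕ → ℕ) (α : ℝ), Computable I ∧ Computable T ∧ 1 ≤ α ∧ α ≤ 2 ∧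
      ∀ n, n ≤ (I n).1 ∧ MemDyadic α (I n) ∧ admissible Δ σ n (T n) (I n) = true := by
  -- A state `⟨p, ⟨a, t⟩⟩` codes a dyadic interval and the precision at which it was found
  -- admissible.
  let iv : ℕ → ℕ × ℕ := fun s => (s.unpair.1, s.unpair.2.unpair.1)
  let pr : ℕ → ℕ := fun s => s.unpair.2.unpair.2
  have hiv : Computable iv := Computable.pair (computable_unpair_fst .id)
    (computable_unpair_fst (computable_unpair_snd .id))
  have hpr : Computable pr := computable_unpair_snd (computable_unpair_snd .id)
  let P : ℕ × ℕ → ℕ → Bool := fun q r => decide ((iv q.2).1 < (iv r).1) &&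
    (decide ((iv r).2 / 2 ^ ((iv r).1 - (iv q.2).1) = (iv q.2).2) && admissible Δ σ q.1 (pr r) (iv r))
  have hP : Computable₂ P := by
    have h1 : Computable fun q : (ℕ × ℕ) × ℕ => iv q.1.2 := hiv.comp (Computable.snd.comp .fst)
    have h2 : Computable fun q : (ℕ × ℕ) × ℕ => iv q.2 := hiv.comp .snd
    have h1' := Computable.fst.comp h1
    have h2' := Computable.fst.comp h2
    exact computable_and (computable_decide_lt h1' h2') (computable_and
      (computable_decide_eq (computable_div (Computable.snd.comp h2)
        (computable_two_pow (computable_sub h2' h1'))) (Computable.snd.comp h1))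
      (computable_admissible hΔc hσc (Computable.fst.comp .fst) (hpr.comp .snd) h2))
  obtain ⟨g, hg, hgP⟩ := exists_computable_choice P hP fun q => by
    obtain ⟨p', a', t, h1, h2, h3⟩ := exists_admissible hΔ hσ q.1 (iv q.2).1 (iv q.2).2
    refine ⟨Nat.pair p' (Nat.pair a' t), ?_⟩
    simp only [P, iv, pr, Nat.unpair_pair, Bool.and_eq_true, decide_eq_true_eq]
    exact ⟨h1, h2, h3⟩
  have hgP' : ∀ n s, (iv s).1 < (iv (g (n, s))).1 ∧
      (iv (g (n, s))).2 / 2 ^ ((iv (g (n, s))).1 - (iv s).1) = (iv s).2 ∧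
      admissible Δ σ n (pr (g (n, s))) (iv (g (n, s))) = true := fun n s => by
    simpa only [P, Bool.and_eq_true, decide_eq_true_eq] using hgP (n, s)
  -- The interval `[1, 2]`, with a dummy precision: admissibility at stage `n` concerns state `n +
  -- 1`, so the initial state is not among the intervals returned.
  let start : ℕ := Nat.pair 0 (Nat.pair 1 0)
  let S : ℕ → ℕ := fun n => Nat.rec start (fun n s => g (n, s)) n
  have hS : Computable S := Computable.nat_rec (h := fun _ q => g q) .id (.const start) (hg.comp .snd)
  have hSs : ∀ n, S (n + 1) = g (n, S n) := fun n => rfl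
  let lo : ℕ → ℝ := fun n => (iv (S n)).2 / 2 ^ (iv (S n)).1
  let hi : ℕ → ℝ := fun n => ((iv (S n)).2 + 1) / 2 ^ (iv (S n)).1
  have hstep : ∀ n, lo n ≤ lo (n + 1) ∧ hi (n + 1) ≤ hi n := by
    intro n
    obtain ⟨h1, h2, -⟩ := hgP' n (S n)
    rw [← hSs] at h1 h2
    obtain ⟨d, hd⟩ := Nat.exists_eq_add_of_lt h1
    have hsub : (iv (S (n + 1))).1 - (iv (S n)).1 = d + 1 := by omega
    rw [hsub, Nat.div_eq_iff (by positivity)] at h2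
    have hpow : (2 : ℝ) ^ (iv (S (n + 1))).1 = 2 ^ (iv (S n)).1 * 2 ^ (d + 1) := by
      rw [← pow_add, hd, add_assoc]
    have h3 : ((iv (S n)).2 : ℝ) * 2 ^ (d + 1) ≤ (iv (S (n + 1))).2 := by
      exact_mod_cast (by nlinarith [h2.1] : (iv (S n)).2 * 2 ^ (d + 1) ≤ (iv (S (n + 1))).2)
    have h4 : ((iv (S (n + 1))).2 : ℝ) + 1 ≤ ((iv (S n)).2 + 1) * 2 ^ (d + 1) := by
      have : (iv (S (n + 1))).2 + 1 ≤ ((iv (S n)).2 + 1) * 2 ^ (d + 1) := by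
        have := h2.2
        have := Nat.two_pow_pos (d + 1)
        rw [add_mul, one_mul]
        omega
      exact_mod_cast this
    constructor
    · simp only [lo]
      rw [div_le_div_iff₀ (by positivity) (by positivity), hpow]
      nlinarith [(by positivity : (0 : ℝ) < 2 ^ (iv (S n)).1)]
    · simp only [hi]
      rw [div_le_div_iff₀ (by positivity) (by positivity), hpow]
      nlinarith [(by positivity : (0 : ℝ) < 2 ^ (iv (S n)).1)]
  have hα := Monotone.ciSup_mem_iInter_Icc_of_antitone (monotone_nat_of_le_succ fun n => (hstep n).1)
    (antitone_nat_of_succ_le fun n => (hstep n).2)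
    (fun n => by simp only [lo, hi]; gcongr; linarith)
  set α := ⨆ n, lo n
  have hα' : ∀ n, lo n ≤ α ∧ α ≤ hi n := fun n => Set.mem_iInter.1 hα n
  refine ⟨fun n => iv (S (n + 1)), fun n => pr (S (n + 1)), α, hiv.comp (hS.comp .succ),
    hpr.comp (hS.comp .succ), ?_, ?_, fun n => ⟨?_, ?_, (hgP' n (S n)).2.2⟩⟩
  · simpa [lo, S, start, iv] using (hα' 0).1
  · have := (hα' 0).2
    norm_num [hi, S, start, iv] at this
    exact this
  · have : ∀ n, n ≤ (iv (S n)).1 := by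
      intro n
      induction n with
      | zero => exact Nat.zero_le _
      | succ n ih =>
        have := (hgP' n (S n)).1
        rw [hSs]
        omega
    exact (Nat.le_succ n).trans (this (n + 1))
  · have h := hα' (n + 1)
    have hp : (0 : ℝ) < 2 ^ (iv (S (n + 1))).1 := by positivity
    exact ⟨(div_le_iff₀ hp).1 h.1, (le_div_iff₀ hp).1 h.2⟩

end Threshold

/-! ### The Cantor space -/

section Cantor

theorem cantor_dist_le {a b : ℕ → Bool} {n : ℕ} (h : ∀ i < n, a i = b i) :
    dist a b ≤ (1 / 2) ^ n :=
  (PiNat.mem_cylinder_iff_dist_le (E := fun _ => Bool)).1 h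

theorem cantor_apply_eq {a b : ℕ → Bool} {n : ℕ} (h : dist a b ≤ (1 / 2) ^ n) {i : ℕ} (hi : i < n) :
    a i = b i :=
  (PiNat.mem_cylinder_iff_dist_le (E := fun _ => Bool)).2 h i hi

/-- The ball is open, so digit `n` is fixed too. -/
theorem cantor_mem_ball {a b : ℕ → Bool} {n : ℕ} :
    b ∈ Metric.ball a ((1 / 2) ^ n) ↔ ∀ i ≤ n, b i = a i := by
  rw [Metric.mem_ball]
  constructor
  · exact fun h i hi => PiNat.apply_eq_of_dist_lt (E := fun _ => Bool) h hi
  · intro h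
    exact (cantor_dist_le fun i hi => h i (Nat.lt_succ_iff.1 hi)).trans_lt
      (pow_lt_pow_right_of_lt_one₀ (by norm_num) (by norm_num) (Nat.lt_succ_self n))

theorem computable_testBit {α : Type*} [Primcodable α] {f g : α → ℕ} (hf : Computable f)
    (hg : Computable g) : Computable fun a => (f a).testBit (g a) := by
  refine (computable_decide_eq (Primrec.nat_mod.to_comp.comp
    (computable_div hf (computable_two_pow hg)) (.const 2)) (.const 1)).of_eq fun a => ?_
  rw [Nat.testBit_eq_decide_div_mod_eq]

/-- The code of the ideal ball of radius `2 ^ (-l)` about the `j`-th ideal point. -/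
def dyadicBall (j l : ℕ) : ℕ := Nat.pair j (Nat.pair 0 (2 ^ l - 1))

theorem idealBall_dyadicBall {X : Type*} [MetricSpace X] [ComputableMetricSpace X] (j l : ℕ) :
    idealBall X (dyadicBall j l) = Metric.ball (ComputableMetricSpace.ideal j) ((1 / 2) ^ l) := by
  have h : 1 ≤ 2 ^ l := Nat.one_le_two_pow
  simp [idealBall, dyadicBall, posRatNum, Nat.cast_sub h]

theorem computable_dyadicBall {α : Type*} [Primcodable α] {f g : α → ℕ} (hf : Computable f)
    (hg : Computable g) : Computable fun a => dyadicBall (f a) (g a) :=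
  computable_pair hf (computable_pair (.const 0) (computable_sub (computable_two_pow hg) (.const 1)))

end Cantor

/-! ### The binary expansion defined by a threshold -/

section Expansion

variable {X : Type*} [MetricSpace X] [ComputableMetricSpace X] [MeasurableSpace X] [BorelSpace X]

/-- A number `α`, computably approximated by the dyadic intervals `I n`, that is not the value of a
level at an ideal point and is the value of each level on a null set only. -/
structure Threshold (μ : ProbabilityMeasure X) where
  /-- The approximations of the distances of the ideal points. -/
  Δ : ℕ → ℕ × ℕ → ℕ
  computable_Δ : Computable₂ Δ
  isDyadicDist : IsDyadicDist X Δ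
  /-- A name of the measure. -/
  σ : ℕ → ℕ
  computable_σ : Computable σ
  cauchyName : CauchyName (fun n => LevyProkhorov.ofMeasure
    (idealMeasure (ComputableMetricSpace.ideal : ℕ → X) n)) σ (LevyProkhorov.ofMeasure μ)
  /-- The dyadic intervals that approximate the threshold. -/
  I : ℕ → ℕ × ℕ
  computable_I : Computable I
  /-- The precisions at which the intervals are admissible. -/
  T : ℕ → ℕ
  computable_T : Computable T
  /-- The threshold. -/
  α : ℝ
  one_le : 1 ≤ α
  le_two : α ≤ 2
  le_fst : ∀ n, n ≤ (I n).1
  mem : ∀ n, MemDyadic α (I n)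
  adm : ∀ n, admissible Δ σ n (T n) (I n) = true

theorem nonempty_threshold {μ : ProbabilityMeasure X} (hμ : IsComputableMeasure μ) :
    Nonempty (Threshold μ) := by
  obtain ⟨Δ, h1, h2⟩ := exists_dyadic_dist X
  obtain ⟨σ, h3, h4⟩ := hμ
  obtain ⟨I, T, α, h5, h6, h7, h8, h9⟩ := exists_threshold h1 h2 h3 h4
  exact ⟨⟨Δ, h1, h2, σ, h3, h4, I, h5, T, h6, α, h7, h8, fun n => (h9 n).1, fun n => (h9 n).2.1,
    fun n => (h9 n).2.2⟩⟩

namespace Threshold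

variable {μ : ProbabilityMeasure X} (θ : Threshold μ)

/-- The sequence that tells which levels of `x` lie below the threshold. -/
noncomputable def expansion (x : X) (n : ℕ) : Bool := decide (level n x < θ.α)

/-- The points none of whose levels equals the threshold. -/
def regular : Set X := {x | ∀ n, level n x ≠ θ.α}

theorem le_T (n : ℕ) : n ≤ θ.T n := by
  have := θ.adm n
  simp only [admissible, Bool.and_eq_true, decide_eq_true_eq] at this
  exact this.1

theorem separated_ideal {n j : ℕ} (h : j ≤ n) : separated θ.Δ (θ.T n) n j (θ.I n) = true := by
  have := θ.adm n
  simp only [admissible, Bool.and_eq_true, allLT_eq_true] at this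
  exact this.2.1 j (Nat.lt_succ_of_le h)

theorem weight_not_separated_le (n : ℕ) :
    (weight (fun j => !separated θ.Δ (θ.T n) n j (θ.I n)) (atoms (θ.σ (θ.T n))) : ℝ)
      / weight (fun _ => true) (atoms (θ.σ (θ.T n))) ≤ (1 / 2) ^ n := by
  have h := θ.adm n
  simp only [admissible, Bool.and_eq_true, decide_eq_true_eq] at h
  have hpos : (0 : ℝ) < weight (fun _ => true) (atoms (θ.σ (θ.T n))) := by
    exact_mod_cast weight_true_pos _
  rw [div_le_iff₀ hpos, one_div_pow, one_div, inv_mul_eq_div, le_div_iff₀ (by positivity)]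
  exact_mod_cast h.2.2

/-- Digits computed at an ideal point are valid for nearby points. The tolerance `4 / 2 ^ t` covers
both the error `2 / 2 ^ t` of an entry of a name and a thickening allowed by a Prokhorov distance
below `4 / 2 ^ t`. -/
theorem separated_spec {t m n j : ℕ} (h : separated θ.Δ t n j (θ.I m) = true) {x : X}
    (hx : dist (ComputableMetricSpace.ideal j) x ≤ 4 / 2 ^ t) {i : ℕ} (hi : i ≤ n) :
    level i x ≠ θ.α ∧ below θ.Δ t i j (θ.I m) = θ.expansion x i :=
  far_spec θ.isDyadicDist (θ.mem m) (separated_eq_true.1 h i hi) hx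

/-- Stage `max n j` of the construction examines both the `j`-th ideal point and the `n`-th level.
-/
theorem ideal_mem_regular (j : ℕ) : (ComputableMetricSpace.ideal j : X) ∈ θ.regular := fun n =>
  (θ.separated_spec (θ.separated_ideal (le_max_right n j)) (by rw [dist_self]; positivity)
    (le_max_left n j)).1

/-- The test `far` is complete: a failure at precision `l` puts level `n` of `x` within `15 * 2 ^
n.unpair.2 / 2 ^ l` of the threshold. The `15` is `4` for the displacement, `9` for the failed test
and `2` for the interval, whose length is at most `2 ^ (-l)`. -/
theorem eventually_far {n : ℕ} {x : X} (hx : level n x ≠ θ.α) : ∀ᶠ l in atTop, ∀ j,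
    dist (ComputableMetricSpace.ideal j) x ≤ 4 / 2 ^ l → far θ.Δ l n j (θ.I l) = true := by
  have hlim : Tendsto (fun l : ℕ => 15 * 2 ^ n.unpair.2 * (1 / 2 : ℝ) ^ l) atTop (𝓝 0) := by
    simpa using (tendsto_pow_atTop_nhds_zero_of_lt_one (by norm_num : (0 : ℝ) ≤ 1 / 2)
      (by norm_num)).const_mul (15 * 2 ^ n.unpair.2 : ℝ)
  filter_upwards [hlim.eventually_lt_const (abs_pos.2 (sub_ne_zero.2 hx))] with l hl j hj
  by_contra hfar
  have h1 := abs_level_sub_le_of_not_far θ.isDyadicDist (θ.mem l) (Bool.eq_false_of_not_eq_true hfar)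
  have h2 := (abs_level_sub_le n x (ComputableMetricSpace.ideal j)).trans
    (mul_le_mul_of_nonneg_left ((dist_comm _ _).trans_le hj) (by positivity))
  have h3 := abs_sub_le (level n x) (level n (ComputableMetricSpace.ideal j : X)) θ.α
  have h4 : (2 : ℝ) / 2 ^ (θ.I l).1 ≤ 2 * 2 ^ n.unpair.2 / 2 ^ l := by
    have h5 : (2 : ℝ) ≤ 2 * 2 ^ n.unpair.2 := by
      have : (1 : ℝ) ≤ 2 ^ n.unpair.2 := one_le_pow₀ (by norm_num)
      linarith
    have h6 : (2 : ℝ) ^ l ≤ 2 ^ (θ.I l).1 := pow_le_pow_right₀ (by norm_num) (θ.le_fst l)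
    gcongr
  have h5 : 15 * 2 ^ n.unpair.2 * (1 / 2 : ℝ) ^ l = 2 ^ n.unpair.2 * (4 / 2 ^ l)
      + (9 * 2 ^ n.unpair.2 / 2 ^ l + 2 * 2 ^ n.unpair.2 / 2 ^ l) := by
    rw [one_div_pow]
    ring
  linarith

theorem eventually_separated {x : X} (hx : x ∈ θ.regular) (n : ℕ) : ∀ᶠ l in atTop, ∀ j,
    dist (ComputableMetricSpace.ideal j) x ≤ 4 / 2 ^ l → separated θ.Δ l n j (θ.I l) = true := by
  have : ∀ᶠ l in atTop, ∀ i ∈ Finset.range (n + 1), ∀ j,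
      dist (ComputableMetricSpace.ideal j) x ≤ 4 / 2 ^ l → far θ.Δ l i j (θ.I l) = true :=
    (eventually_all_finset _).2 fun i _ => θ.eventually_far (hx i)
  filter_upwards [this] with l hl j hj
  exact separated_eq_true.2 fun i hi => hl i (Finset.mem_range.2 (by omega)) j hj

theorem dense_regular : Dense θ.regular :=
  Dense.mono (Set.range_subset_iff.2 θ.ideal_mem_regular) ComputableMetricSpace.denseRange_ideal

/-- The complement of each level set is the union of the balls `B(s j, 2 ^ (-l))` that pass the test
`far`, which is sound by `far_spec` and complete by `eventually_far`. -/
theorem isPiZeroTwo_regular : IsPiZeroTwo θ.regular := by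
  refine ⟨fun n => {x | level n x ≠ θ.α}, uniformlyREOpen_of_computable
    (P := fun n q => far θ.Δ q.unpair.2 n q.unpair.1 (θ.I q.unpair.2))
    (g := fun _ q => dyadicBall q.unpair.1 q.unpair.2) ?_ ?_ ?_, ?_⟩
  · have h : Computable fun q : ℕ × ℕ => q.2.unpair.2 := computable_unpair_snd .snd
    exact computable_far θ.computable_Δ h .fst (computable_unpair_fst .snd) (θ.computable_I.comp h)
  · exact computable_dyadicBall (computable_unpair_fst .snd) (computable_unpair_snd .snd)
  · intro n x
    constructor
    · intro hx
      obtain ⟨l, hl⟩ := (θ.eventually_far hx).exists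
      obtain ⟨j, hj⟩ := exists_ideal_dist_lt x (show (0 : ℝ) < (1 / 2) ^ l by positivity)
      refine ⟨Nat.pair j l, ?_, ?_⟩
      · simp only [Nat.unpair_pair]
        refine hl j (hj.le.trans ?_)
        rw [one_div_pow]
        gcongr
        norm_num
      · simp only [Nat.unpair_pair, idealBall_dyadicBall]
        rwa [Metric.mem_ball']
    · rintro ⟨q, hq, hx⟩
      rw [idealBall_dyadicBall, Metric.mem_ball'] at hx
      refine (far_spec θ.isDyadicDist (θ.mem _) hq (hx.le.trans ?_)).1
      rw [one_div_pow]
      gcongr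
      norm_num
  · ext x
    simp [regular]

theorem dist_idealMeasure_lt (t : ℕ) : dist (LevyProkhorov.ofMeasure μ) (LevyProkhorov.ofMeasure
    (idealMeasure (ComputableMetricSpace.ideal : ℕ → X) (θ.σ t))) < 4 / 2 ^ t := by
  rw [dist_comm]
  exact (θ.cauchyName.dist_le t).trans_lt (by gcongr; norm_num)

theorem four_div_two_pow_T_le (n : ℕ) : (4 : ℝ) / 2 ^ θ.T n ≤ 4 * (1 / 2) ^ n := by
  rw [one_div_pow, mul_one_div]
  have := θ.le_T n
  gcongr
  norm_num

/-- For `n ≥ i`, an atom close to the level set cannot be separated at stage `n`, so such atoms have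
mass at most `2 ^ (-n)` in the ideal measure. The Prokhorov error adds at most `4 * 2 ^ (-n)`. -/
theorem measure_level_eq (i : ℕ) : (μ : Measure X) {x | level i x = θ.α} = 0 := by
  rw [← measureReal_eq_zero_iff]
  refine le_antisymm ?_ measureReal_nonneg
  have hlim : Tendsto (fun n : ℕ => 5 * (1 / 2 : ℝ) ^ n) atTop (𝓝 0) := by
    simpa using (tendsto_pow_atTop_nhds_zero_of_lt_one (by norm_num : (0 : ℝ) ≤ 1 / 2)
      (by norm_num)).const_mul (5 : ℝ)
  refine ge_of_tendsto hlim ?_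
  filter_upwards [eventually_ge_atTop i] with n hn
  have hm : MeasurableSet {x : X | level i x = θ.α} :=
    (isClosed_eq (continuous_level i) continuous_const).measurableSet
  have h1 := measureReal_le_of_dist_lt (θ.dist_idealMeasure_lt (θ.T n)) hm
  have h2 := idealMeasure_real_le (ComputableMetricSpace.ideal : ℕ → X) (θ.σ (θ.T n))
    (A := Metric.thickening (4 / 2 ^ θ.T n) {x : X | level i x = θ.α})
    Metric.isOpen_thickening.measurableSet (b := fun j => !separated θ.Δ (θ.T n) n j (θ.I n))
    fun j hj => by
      obtain ⟨y, hy, hjy⟩ := Metric.mem_thickening_iff.1 hj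
      by_contra hsep
      exact (θ.separated_spec (by simpa using hsep) hjy.le hn).1 hy
  have h3 := θ.weight_not_separated_le n
  have h4 := θ.four_div_two_pow_T_le n
  linarith

theorem measure_regular : (μ : Measure X) θ.regular = 1 := by
  rw [← prob_compl_eq_zero_iff θ.isPiZeroTwo_regular.measurableSet]
  refine measure_mono_null ?_ (measure_iUnion_null θ.measure_level_eq)
  intro x hx
  simpa [regular] using hx

theorem computableOn_expansion : ComputableOn fun x : θ.regular => θ.expansion x := by
  -- A certificate is the last entry `j` of the prefix, tested at the precision given by its
  -- position. Once levels `0, …, m` are separated, their digits code an ideal point of the Cantor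
  -- space within `2 ^ (-(m + 1))` of the expansion.
  let c : ℕ → List ℕ → Option ℕ := fun m u => u[u.length - 1]?.bind fun j =>
    bif separated θ.Δ (u.length - 1) m j (θ.I (u.length - 1))
      then some (digits θ.Δ (u.length - 1) m j (θ.I (u.length - 1))) else none
  have hc : Computable₂ c := by
    have hl : Computable fun q : ℕ × List ℕ => q.2.length - 1 :=
      computable_sub (Computable.list_length.comp .snd) (.const 1)
    have hl' : Computable fun q : (ℕ × List ℕ) × ℕ => q.1.2.length - 1 := hl.comp .fst
    refine Computable.option_bind (Computable.list_getElem?.comp .snd hl) (Computable.cond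
      (computable_separated θ.computable_Δ hl' (Computable.fst.comp .fst) .snd
        (θ.computable_I.comp hl')) ?_ (.const none))
    exact Computable.option_some.comp (computable_digits θ.computable_Δ hl'
      (Computable.fst.comp .fst) .snd (θ.computable_I.comp hl'))
  have hcs : ∀ (m : ℕ) (σ : ℕ → ℕ) (l : ℕ), c m (initSeg σ (l + 1)) =
      bif separated θ.Δ l m (σ l) (θ.I l) then some (digits θ.Δ l m (σ l) (θ.I l)) else none := by
    intro m σ l
    simp only [c, length_initSeg, Nat.add_sub_cancel, getElem?_initSeg σ (Nat.lt_succ_self l),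
      Option.bind_some]
  have hdist : ∀ {x : X} {σ : ℕ → ℕ}, CauchyName ComputableMetricSpace.ideal σ x → ∀ l,
      dist (ComputableMetricSpace.ideal (σ l)) x ≤ 4 / 2 ^ l := fun hσ l =>
    (hσ.dist_le l).trans (by gcongr; norm_num)
  refine computableOn_of_certificates hc ?_ ?_
  · intro x σ hσ m
    obtain ⟨l, hl⟩ := (θ.eventually_separated x.2 m).exists
    refine ⟨l + 1, ?_⟩
    rw [hcs, hl _ (hdist hσ l)]
    rfl
  · intro x σ τ hσ hτ
    refine cauchyName_of_dist_le fun m => cantor_dist_le fun i hi => ?_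
    obtain ⟨k, hk⟩ := hτ m
    cases k with
    | zero => simp [c, initSeg] at hk
    | succ l =>
      rw [hcs] at hk
      cases hs : separated θ.Δ l m (σ l) (θ.I l)
      · simp [hs] at hk
      · rw [hs, cond_true, Option.some_inj] at hk
        show (τ m).testBit i = _
        rw [← hk, testBit_digits _ _ _ _ (Nat.lt_succ_iff.1 hi)]
        exact (θ.separated_spec hs (hdist hσ l) (Nat.lt_succ_iff.1 hi)).2

/-! ### The distribution of the expansions -/

theorem measurable_expansion : Measurable θ.expansion := by
  refine measurable_pi_iff.2 fun n => measurable_to_bool ?_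
  have : (fun x => θ.expansion x n) ⁻¹' {true} = {x | level n x < θ.α} := by
    ext x
    simp [expansion]
  rw [this]
  exact (isOpen_lt (continuous_level n) continuous_const).measurableSet

/-- The distribution of the expansions. -/
noncomputable def law : ProbabilityMeasure (ℕ → Bool) := μ.map θ.measurable_expansion.aemeasurable

theorem law_apply {A : Set (ℕ → Bool)} (hA : MeasurableSet A) :
    (θ.law : Measure (ℕ → Bool)) A = (μ : Measure X) (θ.expansion ⁻¹' A) := by
  rw [law, ProbabilityMeasure.toMeasure_map, Measure.map_apply θ.measurable_expansion hA]

/-- The index of the ideal measure on the Cantor space that approximates the distribution. -/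
def lawApprox (n : ℕ) : ℕ :=
  let c := Denumerable.ofNat ((ℕ × ℕ) × List (ℕ × ℕ)) (θ.σ (θ.T n))
  Encodable.encode ((digits θ.Δ (θ.T n) n c.1.1 (θ.I n), c.1.2),
    c.2.map fun q => (digits θ.Δ (θ.T n) n q.1 (θ.I n), q.2))

theorem atoms_lawApprox (n : ℕ) : atoms (θ.lawApprox n)
    = (atoms (θ.σ (θ.T n))).map fun q => (digits θ.Δ (θ.T n) n q.1 (θ.I n), q.2) := by
  simp only [atoms, lawApprox, Denumerable.ofNat_encode, List.map_cons]

theorem computable_lawApprox : Computable θ.lawApprox := by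
  have hc : Computable fun n => Denumerable.ofNat ((ℕ × ℕ) × List (ℕ × ℕ)) (θ.σ (θ.T n)) :=
    computable_ofNat_atoms.comp (θ.computable_σ.comp θ.computable_T)
  have hd : Computable₂ fun (n : ℕ) (q : ℕ × ℕ) => (digits θ.Δ (θ.T n) n q.1 (θ.I n), q.2) :=
    Computable.pair (computable_digits θ.computable_Δ (θ.computable_T.comp .fst) .fst
      (Computable.fst.comp .snd) (θ.computable_I.comp .fst)) (Computable.snd.comp .snd)
  exact Computable.encode.comp (Computable.pair (hd.comp .id (Computable.fst.comp hc))
    (computable_list_map (Computable.snd.comp hc) hd))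

theorem weight_lawApprox (b : ℕ → Bool) (n : ℕ) : weight b (atoms (θ.lawApprox n))
    = weight (fun j => b (digits θ.Δ (θ.T n) n j (θ.I n))) (atoms (θ.σ (θ.T n))) := by
  rw [atoms_lawApprox, weight, weight, List.map_map]
  rfl

/-- A separated atom near the preimage of `B` is sent within `2 ^ (-n)` of `B`, and the unseparated
ones have mass at most `2 ^ (-n)`. Passing from `μ` to the ideal measure costs at most `4 * 2 ^
(-n)`. The total `5` is rounded up to a power of two for `constructivePoint_of_dist_le`. -/
theorem dist_law_le (n : ℕ) : dist (LevyProkhorov.ofMeasure (idealMeasure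
    (ComputableMetricSpace.ideal : ℕ → (ℕ → Bool)) (θ.lawApprox n))) (LevyProkhorov.ofMeasure θ.law)
      ≤ 2 ^ 3 * (1 / 2) ^ n := by
  classical
  rw [dist_comm, LevyProkhorov.dist_probabilityMeasure_def]
  -- For probability measures one of the two Prokhorov inequalities suffices.
  refine levyProkhorovDist_le_of_forall_le _ _ (by positivity) fun ε B hε hB => ?_
  have hn0 : (0 : ℝ) < (1 / 2) ^ n := by positivity
  have hε0 : 0 < ε := lt_of_le_of_lt (by positivity) hε
  show (θ.law : Measure (ℕ → Bool)) B ≤ (idealMeasure (ComputableMetricSpace.ideal :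
    ℕ → (ℕ → Bool)) (θ.lawApprox n) : Measure (ℕ → Bool)) (Metric.thickening ε B) + _
  rw [θ.law_apply hB]
  set t := θ.T n with ht
  have h1 := measureReal_le_of_dist_lt (θ.dist_idealMeasure_lt t) (θ.measurable_expansion hB)
  have h2 := idealMeasure_real_le (ComputableMetricSpace.ideal : ℕ → X) (θ.σ t)
    (A := Metric.thickening (4 / 2 ^ t) (θ.expansion ⁻¹' B))
    Metric.isOpen_thickening.measurableSet (b := fun j => decide
      ((ComputableMetricSpace.ideal j : X) ∈ Metric.thickening (4 / 2 ^ t) (θ.expansion ⁻¹' B)))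
    fun j hj => by simpa using hj
  have h3 := le_idealMeasure_real (ComputableMetricSpace.ideal : ℕ → (ℕ → Bool)) (θ.lawApprox n)
    (A := Metric.thickening ε B) (b := fun j => decide
      ((ComputableMetricSpace.ideal j : ℕ → Bool) ∈ Metric.thickening ε B))
    fun j hj => by simpa using hj
  rw [weight_lawApprox, weight_lawApprox] at h3
  have h4 := weight_mono_or (b := fun j => decide
      ((ComputableMetricSpace.ideal j : X) ∈ Metric.thickening (4 / 2 ^ t) (θ.expansion ⁻¹' B)))
    (c := fun j => !separated θ.Δ t n j (θ.I n))
    (d := fun j => decide ((ComputableMetricSpace.ideal (digits θ.Δ t n j (θ.I n)) : ℕ → Bool)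
      ∈ Metric.thickening ε B)) (fun j hj => by
      rw [decide_eq_true_eq] at hj
      obtain ⟨x, hx, hjx⟩ := Metric.mem_thickening_iff.1 hj
      cases hs : separated θ.Δ t n j (θ.I n)
      · left; rfl
      · right
        rw [decide_eq_true_eq]
        refine Metric.mem_thickening_iff.2 ⟨θ.expansion x, hx, ?_⟩
        refine (cantor_dist_le (n := n) fun i hi => ?_).trans_lt (by linarith)
        show (digits θ.Δ t n j (θ.I n)).testBit i = _
        rw [testBit_digits _ _ _ _ hi.le]
        exact (θ.separated_spec hs hjx.le hi.le).2) (atoms (θ.σ t))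
  have hpos : (0 : ℝ) < weight (fun _ => true) (atoms (θ.σ t)) := by
    exact_mod_cast weight_true_pos _
  have h5 := div_le_div_of_nonneg_right (Nat.cast_le (α := ℝ).2 h4) hpos.le
  rw [Nat.cast_add, add_div] at h5
  have h6 := θ.weight_not_separated_le n
  have h7 := θ.four_div_two_pow_T_le n
  have h8 : (μ : Measure X).real (θ.expansion ⁻¹' B) ≤ (idealMeasure (ComputableMetricSpace.ideal :
      ℕ → (ℕ → Bool)) (θ.lawApprox n) : Measure (ℕ → Bool)).real (Metric.thickening ε B) + ε := by
    linarith
  rw [← ofReal_measureReal, ← ofReal_measureReal, ← ENNReal.ofReal_add measureReal_nonneg hε0.le]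
  exact ENNReal.ofReal_le_ofReal h8

theorem isComputableMeasure_law : IsComputableMeasure θ.law :=
  constructivePoint_of_dist_le θ.computable_lawApprox 3 θ.dist_law_le

end Threshold

end Expansion

/-! ### The decoding map -/

section Decoding

variable {X : Type*} [MetricSpace X] [ComputableMetricSpace X] [MeasurableSpace X] [BorelSpace X]

namespace Threshold

variable {μ : ProbabilityMeasure X} (θ : Threshold μ)

/-- The sequence `ω` is a possible expansion of `x`, ties being broken arbitrarily. -/
def Represents (ω : ℕ → Bool) (x : X) : Prop :=
  ∀ n, (ω n = true → level n x ≤ θ.α) ∧ (ω n = false → θ.α ≤ level n x)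

/-- The sequences that have digit `1` at each scale and whose prefixes are prefixes of expansions of
ideal points. -/
def codes : Set (ℕ → Bool) :=
  {ω | ∀ N, ∃ i j, θ.expansion (ComputableMetricSpace.ideal j) (Nat.pair i N) = true ∧
    ∀ n ≤ Nat.pair i N, ω n = θ.expansion (ComputableMetricSpace.ideal j) n}

theorem exists_apply_eq_true {ω : ℕ → Bool} (hω : ω ∈ θ.codes) (N : ℕ) :
    ∃ i, ω (Nat.pair i N) = true := by
  obtain ⟨i, j, h1, h2⟩ := hω N
  exact ⟨i, (h2 _ le_rfl).trans h1⟩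

theorem dist_ideal_le {i k : ℕ} {x : X} (h : level (Nat.pair i k) x ≤ θ.α) :
    dist (ComputableMetricSpace.ideal i) x ≤ 2 * (1 / 2) ^ k := by
  unfold level at h
  simp only [Nat.unpair_pair] at h
  rw [one_div_pow, mul_one_div, le_div_iff₀ (by positivity), mul_comm]
  exact h.trans θ.le_two

theorem Represents.dist_le {θ : Threshold μ} {ω : ℕ → Bool} {x : X} (h : θ.Represents ω x) {i k : ℕ}
    (hi : ω (Nat.pair i k) = true) : dist (ComputableMetricSpace.ideal i) x ≤ 2 * (1 / 2) ^ k :=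
  θ.dist_ideal_le ((h _).1 hi)

/-- At every scale `k` a digit `1` places both points within `2 * 2 ^ (-k)` of one ideal point,
since `α ≤ 2`. -/
theorem Represents.unique {ω : ℕ → Bool} (hω : ω ∈ θ.codes) {x y : X} (hx : θ.Represents ω x)
    (hy : θ.Represents ω y) : x = y := by
  refine dist_le_zero.1 ?_
  have hlim : Tendsto (fun n : ℕ => 4 * (1 / 2 : ℝ) ^ n) atTop (𝓝 0) := by
    simpa using (tendsto_pow_atTop_nhds_zero_of_lt_one (by norm_num : (0 : ℝ) ≤ 1 / 2)
      (by norm_num)).const_mul (4 : ℝ)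
  refine ge_of_tendsto' hlim fun k => ?_
  obtain ⟨i, hi⟩ := θ.exists_apply_eq_true hω k
  have := dist_triangle_left x y (ComputableMetricSpace.ideal i)
  linarith [hx.dist_le hi, hy.dist_le hi]

theorem Represents.eq_expansion {θ : Threshold μ} {ω : ℕ → Bool} {x : X} (h : θ.Represents ω x)
    (hx : x ∈ θ.regular) : ω = θ.expansion x := by
  funext n
  cases hn : ω n
  · exact (decide_eq_false (not_lt.2 ((h n).2 hn))).symm
  · exact (decide_eq_true (lt_of_le_of_ne ((h n).1 hn) (hx n))).symm

/-- Strict inequalities become weak in the limit, which is why `Represents` leaves ties open. -/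
theorem represents_of_tendsto {u : ℕ → X} {x : X} {ω : ℕ → Bool} (hu : Tendsto u atTop (𝓝 x))
    (hω : ∀ n, ∀ᶠ m in atTop, θ.expansion (u m) n = ω n) : θ.Represents ω x := by
  intro n
  have hlim : Tendsto (fun m => level n (u m)) atTop (𝓝 (level n x)) :=
    ((continuous_level n).tendsto x).comp hu
  refine ⟨fun h => le_of_tendsto hlim ?_, fun h => ge_of_tendsto hlim ?_⟩
  · filter_upwards [hω n] with m hm
    rw [h] at hm
    exact (of_decide_eq_true hm).le
  · filter_upwards [hω n] with m hm
    rw [h] at hm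
    exact not_lt.1 (of_decide_eq_false hm)

/-- The ideal points whose expansions share longer and longer prefixes with `ω` form a Cauchy
sequence: the digit `1` at scale `k` eventually confines them to a ball of radius `2 * 2 ^ (-k)`.
Their limit is represented by `ω`. -/
theorem exists_represents {ω : ℕ → Bool} (hω : ω ∈ θ.codes) : ∃ x, θ.Represents ω x := by
  choose i j hone hagree using hω
  set u : ℕ → X := fun N => ComputableMetricSpace.ideal (j N) with hu
  have hexp : ∀ n N, n ≤ N → θ.expansion (u N) n = ω n := fun n N h =>
    (hagree N n (h.trans (Nat.right_le_pair _ _))).symm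
  have hclose : ∀ k N, Nat.pair (i k) k ≤ N →
      dist (ComputableMetricSpace.ideal (i k)) (u N) ≤ 2 * (1 / 2) ^ k := by
    intro k N hN
    have h1 : θ.expansion (u N) (Nat.pair (i k) k) = true := by
      rw [hexp _ _ hN, hagree k _ le_rfl, hone k]
    exact θ.dist_ideal_le (of_decide_eq_true h1).le
  have hcauchy : CauchySeq u := by
    refine Metric.cauchySeq_iff'.2 fun ε hε => ?_
    obtain ⟨k, hk⟩ := exists_pow_lt_of_lt_one (div_pos hε four_pos)
      (by norm_num : (1 / 2 : ℝ) < 1)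
    refine ⟨Nat.pair (i k) k, fun N hN => ?_⟩
    have h1 := hclose k N hN
    have h2 := hclose k _ le_rfl
    have h3 := dist_triangle_left (u N) (u (Nat.pair (i k) k)) (ComputableMetricSpace.ideal (i k))
    rw [lt_div_iff₀ four_pos] at hk
    linarith
  obtain ⟨x, hx⟩ := cauchySeq_tendsto_of_complete hcauchy
  refine ⟨x, θ.represents_of_tendsto hx fun n => ?_⟩
  filter_upwards [eventually_ge_atTop n] with N hN
  exact hexp n N hN

/-- The point with a given expansion. -/
noncomputable def decode (ω : θ.codes) : X := (θ.exists_represents ω.2).choose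

theorem represents_decode (ω : θ.codes) : θ.Represents ω (θ.decode ω) :=
  (θ.exists_represents ω.2).choose_spec

/-- Expansions of ideal points tending to `x` have a limit point by compactness, and it represents
`x`. It is a code because `1 ≤ α`: an ideal point within `2 ^ (-N)` of `x` has its level strictly
below the threshold at `x`, hence also at nearby ideal points. -/
theorem surjective_decode : Function.Surjective θ.decode := by
  intro x
  have hdense : ∀ m : ℕ, ∃ j, dist (ComputableMetricSpace.ideal j) x < (1 / 2) ^ m :=
    fun m => exists_ideal_dist_lt x (by positivity)
  choose j hj using hdense
  have hjx : Tendsto (fun m => (ComputableMetricSpace.ideal (j m) : X)) atTop (𝓝 x) := by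
    rw [tendsto_iff_dist_tendsto_zero]
    exact squeeze_zero (fun _ => dist_nonneg) (fun m => (hj m).le)
      (tendsto_pow_atTop_nhds_zero_of_lt_one (by norm_num) (by norm_num))
  obtain ⟨ω, φ, hφ, hω⟩ := CompactSpace.tendsto_subseq
    fun m => θ.expansion (ComputableMetricSpace.ideal (j m) : X)
  have hu := hjx.comp hφ.tendsto_atTop
  have hev : ∀ n, ∀ᶠ m in atTop,
      θ.expansion (ComputableMetricSpace.ideal (j (φ m)) : X) n = ω n := fun n => by
    have := (tendsto_pi_nhds.1 hω n)
    rw [nhds_discrete, tendsto_pure] at this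
    exact this
  have hmem : ω ∈ θ.codes := by
    intro N
    obtain ⟨i, hi⟩ := exists_ideal_dist_lt x (show (0 : ℝ) < (1 / 2) ^ N by positivity)
    have hlt : level (Nat.pair i N) x < θ.α := by
      refine lt_of_lt_of_le ?_ θ.one_le
      unfold level
      simp only [Nat.unpair_pair]
      rw [one_div_pow, lt_div_iff₀ (by positivity)] at hi
      rwa [mul_comm]
    have h1 : ∀ᶠ m in atTop, level (Nat.pair i N) (ComputableMetricSpace.ideal (j (φ m)) : X) < θ.α :=
      (((continuous_level _).tendsto x).comp hu).eventually_lt_const hlt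
    have h2 : ∀ᶠ m in atTop, ∀ n ∈ Finset.range (Nat.pair i N + 1),
        θ.expansion (ComputableMetricSpace.ideal (j (φ m)) : X) n = ω n :=
      (eventually_all_finset _).2 fun n _ => hev n
    obtain ⟨m, hm1, hm2⟩ := (h1.and h2).exists
    exact ⟨i, j (φ m), decide_eq_true hm1, fun n hn =>
      (hm2 n (Finset.mem_range.2 (by omega))).symm⟩
  exact ⟨⟨ω, hmem⟩, Represents.unique θ hmem (θ.represents_decode ⟨ω, hmem⟩)
    (θ.represents_of_tendsto hu hev)⟩

/-- No ties occur at a regular point, so its code is forced; surjectivity provides one. -/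
theorem decode_eq_iff {x : X} (hx : x ∈ θ.regular) (ω : θ.codes) :
    θ.decode ω = x ↔ (ω : ℕ → Bool) = θ.expansion x := by
  constructor
  · rintro rfl
    exact (θ.represents_decode ω).eq_expansion hx
  · intro h
    obtain ⟨ω', rfl⟩ := θ.surjective_decode x
    have := (θ.represents_decode ω').eq_expansion hx
    rw [Subtype.ext (h.trans this.symm)]

theorem expansion_mem_codes {x : X} (hx : x ∈ θ.regular) : θ.expansion x ∈ θ.codes := by
  obtain ⟨ω, rfl⟩ := θ.surjective_decode x
  rw [← (θ.decode_eq_iff hx ω).1 rfl]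
  exact ω.2

/-- Ideal points are regular, so any finite prefix of their expansions is found by a search over the
precision `l`. The condition at `N` is then a union of cylinders enumerated by triples `⟨i, ⟨j,
l⟩⟩`. -/
theorem isPiZeroTwo_codes : IsPiZeroTwo θ.codes := by
  refine ⟨fun N => {ω | ∃ i j, θ.expansion (ComputableMetricSpace.ideal j) (Nat.pair i N) = true ∧
    ∀ n ≤ Nat.pair i N, ω n = θ.expansion (ComputableMetricSpace.ideal j) n},
    uniformlyREOpen_of_computable
    (P := fun N q => separated θ.Δ q.unpair.2.unpair.2 (Nat.pair q.unpair.1 N) q.unpair.2.unpair.1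
        (θ.I q.unpair.2.unpair.2) &&
      below θ.Δ q.unpair.2.unpair.2 (Nat.pair q.unpair.1 N) q.unpair.2.unpair.1
        (θ.I q.unpair.2.unpair.2))
    (g := fun N q => dyadicBall (digits θ.Δ q.unpair.2.unpair.2 (Nat.pair q.unpair.1 N)
      q.unpair.2.unpair.1 (θ.I q.unpair.2.unpair.2)) (Nat.pair q.unpair.1 N)) ?_ ?_ ?_, ?_⟩
  rotate_left 2
  · have key : ∀ N i j l ω, (separated θ.Δ l (Nat.pair i N) j (θ.I l) = true) →
        ((below θ.Δ l (Nat.pair i N) j (θ.I l) = true ∧ ω ∈ idealBall (ℕ → Bool)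
          (dyadicBall (digits θ.Δ l (Nat.pair i N) j (θ.I l)) (Nat.pair i N))) ↔
        (θ.expansion (ComputableMetricSpace.ideal j) (Nat.pair i N) = true ∧
          ∀ n ≤ Nat.pair i N, ω n = θ.expansion (ComputableMetricSpace.ideal j) n)) := by
      intro N i j l ω hs
      have hspec : ∀ n ≤ Nat.pair i N, below θ.Δ l n j (θ.I l)
          = θ.expansion (ComputableMetricSpace.ideal j) n := fun n hn =>
        (θ.separated_spec hs (by rw [dist_self]; positivity) hn).2
      rw [idealBall_dyadicBall, cantor_mem_ball, hspec _ le_rfl]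
      refine and_congr_right fun _ => forall₂_congr fun n hn => ?_
      show ω n = (digits θ.Δ l (Nat.pair i N) j (θ.I l)).testBit n ↔ _
      rw [testBit_digits _ _ _ _ hn, hspec n hn]
    intro N ω
    constructor
    · rintro ⟨i, j, h⟩
      obtain ⟨l, hl⟩ := (θ.eventually_separated (θ.ideal_mem_regular j) (Nat.pair i N)).exists
      have hs := hl j (by rw [dist_self]; positivity)
      have h' := (key N i j l ω hs).2 h
      refine ⟨Nat.pair i (Nat.pair j l), ?_⟩
      simp only [Nat.unpair_pair, Bool.and_eq_true]
      exact ⟨⟨hs, h'.1⟩, h'.2⟩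
    · rintro ⟨q, hq, hω⟩
      rw [Bool.and_eq_true] at hq
      exact ⟨_, _, (key N _ _ _ ω hq.1).1 ⟨hq.2, hω⟩⟩
  · ext ω
    simp [codes]
  all_goals
    have hi : Computable fun q : ℕ × ℕ => Nat.pair q.2.unpair.1 q.1 :=
      computable_pair (computable_unpair_fst .snd) .fst
    have hj : Computable fun q : ℕ × ℕ => q.2.unpair.2.unpair.1 :=
      computable_unpair_fst (computable_unpair_snd .snd)
    have hl : Computable fun q : ℕ × ℕ => q.2.unpair.2.unpair.2 :=
      computable_unpair_snd (computable_unpair_snd .snd)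
    have hI := θ.computable_I.comp hl
  · exact computable_and (computable_separated θ.computable_Δ hl hi hj hI)
      (computable_below θ.computable_Δ hl hi hj hI)
  · exact computable_dyadicBall (computable_digits θ.computable_Δ hl hi hj hI) hi

theorem computableOn_decode : ComputableOn θ.decode := by
  -- Entry `l + 2` of a name of `ω` has error at most `2 ^ (-(l + 1))`, so it determines digit `l`;
  -- hence a prefix of length `l + 3` is read. If `l = ⟨i, m + 2⟩` and this digit is `1`, then the
  -- `i`-th ideal point is within `2 * 2 ^ (-(m + 2))` of the decoded point, as entry `m` of the
  -- output requires.
  let c : ℕ → List ℕ → Option ℕ := fun m u => u[u.length - 1]?.bind fun a =>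
    bif decide ((u.length - 3).unpair.2 = m + 2) && a.testBit (u.length - 3)
      then some (u.length - 3).unpair.1 else none
  have hc : Computable₂ c := by
    have hl : ∀ n, Computable fun q : ℕ × List ℕ => q.2.length - n := fun n =>
      computable_sub (Computable.list_length.comp .snd) (.const n)
    have hl' : Computable fun q : (ℕ × List ℕ) × ℕ => q.1.2.length - 3 := (hl 3).comp .fst
    refine Computable.option_bind (Computable.list_getElem?.comp .snd (hl 1)) (Computable.cond
      (computable_and (computable_decide_eq (computable_unpair_snd hl')
        (computable_add (Computable.fst.comp .fst) (.const 2))) (computable_testBit .snd hl'))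
      (Computable.option_some.comp (computable_unpair_fst hl')) (.const none))
  have hcs : ∀ (m : ℕ) (σ : ℕ → ℕ) (l : ℕ), c m (initSeg σ (l + 3)) =
      bif decide (l.unpair.2 = m + 2) && (σ (l + 2)).testBit l
        then some l.unpair.1 else none := by
    intro m σ l
    have h : l + 3 - 1 = l + 2 := rfl
    simp only [c, length_initSeg, Nat.add_sub_cancel, h,
      getElem?_initSeg σ (Nat.lt_succ_self (l + 2)), Option.bind_some]
  have hbit : ∀ {ω : ℕ → Bool} {σ : ℕ → ℕ}, CauchyName ComputableMetricSpace.ideal σ ω →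
      ∀ l, (σ (l + 2)).testBit l = ω l := by
    intro ω σ hσ l
    refine cantor_apply_eq (a := (σ (l + 2)).testBit) (n := l + 1) ((hσ.dist_le (l + 2)).trans_eq ?_)
      (Nat.lt_succ_self l)
    rw [one_div_pow, pow_succ 2 (l + 1)]
    field_simp
  refine computableOn_of_certificates hc ?_ ?_
  · intro ω σ hσ m
    obtain ⟨i, hi⟩ := θ.exists_apply_eq_true ω.2 (m + 2)
    refine ⟨Nat.pair i (m + 2) + 3, ?_⟩
    rw [hcs, hbit hσ, hi]
    simp
  · intro ω σ τ hσ hτ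
    refine cauchyName_of_dist_le fun m => ?_
    obtain ⟨k, hk⟩ := hτ m
    obtain ⟨l, hl2, hlω, hlτ⟩ : ∃ l : ℕ, l.unpair.2 = m + 2 ∧ (ω : ℕ → Bool) l = true ∧
        l.unpair.1 = τ m := by
      -- Prefixes shorter than `3` truncate to index `0`, whose scale is `0` and not `m + 2`, so
      -- they certify nothing.
      rcases lt_or_ge k 3 with hk3 | hk3
      · have h0 : k - 3 = 0 := by omega
        simp [c, length_initSeg, h0] at hk
      · obtain ⟨l, rfl⟩ := Nat.exists_eq_add_of_le' hk3
        rw [hcs, hbit hσ] at hk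
        cases hb : (decide (l.unpair.2 = m + 2) && (ω : ℕ → Bool) l)
        · simp [hb] at hk
        · rw [hb, cond_true, Option.some_inj] at hk
          rw [Bool.and_eq_true, decide_eq_true_eq] at hb
          exact ⟨l, hb.1, hb.2, hk⟩
    have hpair : Nat.pair (τ m) (m + 2) = l := by rw [← hl2, ← hlτ, Nat.pair_unpair]
    refine ((θ.represents_decode ω).dist_le (by rw [hpair]; exact hlω)).trans_eq ?_
    rw [pow_succ (1 / 2 : ℝ) (m + 1)]
    ring

theorem measure_codes : (θ.law : Measure (ℕ → Bool)) θ.codes = 1 := by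
  rw [θ.law_apply θ.isPiZeroTwo_codes.measurableSet]
  refine le_antisymm prob_le_one (θ.measure_regular.symm.trans_le (measure_mono ?_))
  exact fun x hx => θ.expansion_mem_codes hx

/-- The decoding map as a morphism. -/
noncomputable def decodeMorphism : Morphism θ.law μ where
  dom := θ.codes
  toFun := θ.decode
  isPiZeroTwo_dom := θ.isPiZeroTwo_codes
  measure_dom := θ.measure_codes
  computable := θ.computableOn_decode
  measure_preimage A hA := by
    rw [θ.law_apply (measurableSet_subtype_preimage θ.isPiZeroTwo_codes.measurableSet
      θ.computableOn_decode.continuous hA)]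
    refine measure_congr ?_
    have hae := (prob_compl_eq_zero_iff θ.isPiZeroTwo_regular.measurableSet).2 θ.measure_regular
    filter_upwards [compl_mem_ae_iff.2 hae] with x hx
    rw [compl_compl] at hx
    have hdec : θ.decode ⟨_, θ.expansion_mem_codes hx⟩ = x := (θ.decode_eq_iff hx _).2 rfl
    refine propext ⟨fun h => ⟨θ.expansion_mem_codes hx, ?_⟩, fun ⟨_, h⟩ => ?_⟩
    · rw [hdec]
      exact h
    · rw [hdec] at h
      exact h

/-- The binary representation defined by a threshold. -/
noncomputable def binaryRepresentation : BinaryRepresentation μ where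
  measure := θ.law
  isComputableMeasure := θ.isComputableMeasure_law
  toMorphism := θ.decodeMorphism
  surjective := θ.surjective_decode
  D := θ.regular
  dense_D := θ.dense_regular
  measure_D := θ.measure_regular
  isPiZeroTwo_D := θ.isPiZeroTwo_regular
  inverse x := θ.expansion x
  fiber_eq x := by
    ext ω
    constructor
    · rintro ⟨h, hω⟩
      exact (θ.decode_eq_iff x.2 ⟨ω, h⟩).1 hω
    · rintro rfl
      exact ⟨θ.expansion_mem_codes x.2, (θ.decode_eq_iff x.2 _).2 rfl⟩
  computable_inverse := θ.computableOn_expansion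

end Threshold

end Decoding

end ComputableProbability

/-! ### The theorem -/

open ComputableProbability
theorem mainTheorem1 {X : Type*} [MetricSpace X] [ComputableMetricSpace X]
    [MeasurableSpace X] [BorelSpace X] (μ : ProbabilityMeasure X) (hμ : IsComputableMeasure μ) :
    Nonempty (BinaryRepresentation μ) ∧
      (∀ R : BinaryRepresentation μ, ∃ I : Isomorphism R.measure μ,
        I.hom = R.toMorphism ∧ I.inv.dom = R.D ∧
          ∀ x : I.inv.dom, R.toMorphism.fiber (x : X) = {I.inv.toFun x}) ∧
      ∃ ν : ProbabilityMeasure (ℕ → Bool), IsComputableMeasure ν ∧ Nonempty (Isomorphism ν μ) := by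
  obtain ⟨θ⟩ := nonempty_threshold hμ
  let R := θ.binaryRepresentation
  exact ⟨⟨R⟩, fun R => ⟨R.isomorphism, rfl, rfl, R.fiber_eq⟩,
    R.measure, R.isComputableMeasure, ⟨R.isomorphism⟩⟩
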